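/- Let $n\ge 2$ and let $\Omega\subset\mathbb C^n$ be a bounded pseudoconvex domain with $C^\infty$-smooth boundary. A defining function of $\Omega$ is a real-valued $C^\infty$ function $\rho$ on an open neighbourhood $V$ of $\overline\Omega$ with $\Omega=\{z\in V:\rho(z)<0\}$ and $d\rho\ne 0$ on $\partial\Omega$. Its Steinness exponent is $$\widetilde\eta_\rho:=\inf\{\eta>1:\ \rho^{\eta}\text{ is strictly plurisubharmonic on }U\setminus\overline\Omega\text{ for some open neighbourhood }U\text{ of }\partial\Omega\},$$ with $\inf\emptyset=\infty$, and the Steinness index of $\Omega$ is $S(\Omega):=\inf_\rho\widetilde\eta_\rho$, the infimum being over all defining functions $\rho$ of $\Omega$. For $(1,0)$ vectors $X=\sum_j X_j\,\partial/\partial z_j$, $Y=\sum_j Y_j\,\partial/\partial z_j$, write $\mathcal L_\rho(X,Y)=\sum_{j,k}\frac{\partial^2\rho}{\partial z_j\partial\bar z_k}X_j\overline{Y_k}$ for the Levi form of $\rho$, let $\nabla\rho$ be the real Euclidean gradient of $\rho$, and let $$N=N_\rho:=\Big(\sum_j\big|\tfrac{\partial\rho}{\partial z_j}\big|^2\Big)^{-1/2}\sum_j\frac{\partial\rho}{\partial\bar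 z_j}\frac{\partial}{\partial z_j}.$$ Let $L$ run over all smooth $(1,0)$ tangent vector fields on $\partial\Omega$ (zeros are allowed), each extended to a smooth $(1,0)$ field with $L\rho=0$ on a neighbourhood of $\partial\Omega$, and put $\Sigma_L:=\{p\in\partial\Omega:\mathcal L_\rho(L,L)(p)=0\}$. For a defining function $\rho$, let $\eta_\rho\in[1,\infty]$ be the infimum of the numbers $\eta_2\in(1,\infty)$ such that $$\frac{1}{\eta_2-1}\,\frac{|\mathcal L_\rho(L,N)|^2}{\|\nabla\rho\|^2}-\frac12\,\frac{N\mathcal L_\rho(L,L)}{\|\nabla\rho\|}\le 0\quad\text{on }\Sigma_L,\ \text{for all such }L,$$ with $\eta_\rho=\infty$ if there is no such $\eta_2$. (On $\Sigma_L$ the number $N\mathcal L_\rho(L,L)$ is real, since $\Omega$ is pseudoconvex.) Then $$S(\Omega)=\inf_\rho\,\eta_\rho,$$ where the infimum is taken over all defining functions $\rho$ of $\Omega$. -/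

import Mathlib

open scoped ContDiff

noncomputable section

/-- The space `ℂⁿ` with its Euclidean norm. A point `z`, and also the coefficient vector
`(x₁, …, xₙ)` of a vector `∑ xⱼ ∂/∂zⱼ` of type `(1,0)`, is an element of this space. -/
abbrev CSpace (n : ℕ) : Type := EuclideanSpace ℂ (Fin n)

/-- `∂f/∂zⱼ = (1/2) (∂f/∂xⱼ - i ∂f/∂yⱼ)`. -/
def dz {n : ℕ} (j : Fin n) (f : CSpace n → ℂ) (z : CSpace n) : ℂ :=
  (1 / 2 : ℂ) * (fderiv ℝ f z (EuclideanSpace.single j 1)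
    - Complex.I * fderiv ℝ f z (EuclideanSpace.single j Complex.I))

/-- `∂f/∂z̄ⱼ = (1/2) (∂f/∂xⱼ + i ∂f/∂yⱼ)`. -/
def dzbar {n : ℕ} (j : Fin n) (f : CSpace n → ℂ) (z : CSpace n) : ℂ :=
  (1 / 2 : ℂ) * (fderiv ℝ f z (EuclideanSpace.single j 1)
    + Complex.I * fderiv ℝ f z (EuclideanSpace.single j Complex.I))

/-- The derivative `x f = ∑ⱼ xⱼ ∂f/∂zⱼ` at `z` of a function along the `(1,0)` vector with
coefficients `x`. -/
def holoDeriv {n : ℕ} (x : CSpace n) (f : CSpace n → ℂ) (z : CSpace n) : ℂ :=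
  ∑ j, x j * dz j f z

/-- A real-valued function regarded as a complex-valued one. -/
def toComplexFun {n : ℕ} (r : CSpace n → ℝ) : CSpace n → ℂ := fun z => (r z : ℂ)

/-- The Levi form `∑ⱼₖ (∂²r/∂zⱼ∂z̄ₖ)(z) xⱼ ȳₖ` of `r` at `z`. -/
def leviForm {n : ℕ} (r : CSpace n → ℝ) (z x y : CSpace n) : ℂ :=
  ∑ j, ∑ k, dz j (dzbar k (toComplexFun r)) z * x j * (starRingEnd ℂ) (y k)

/-- The coefficients of the complex normal field
`N = (∑ⱼ |∂ρ/∂zⱼ|²)^(-1/2) ∑ⱼ (∂ρ/∂z̄ⱼ) ∂/∂zⱼ`. -/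
def complexNormal {n : ℕ} (ρ : CSpace n → ℝ) (z : CSpace n) : CSpace n :=
  WithLp.toLp 2 fun j =>
    dzbar j (toComplexFun ρ) z / (Real.sqrt (∑ k, ‖dz k (toComplexFun ρ) z‖ ^ 2) : ℂ)

/-- The Euclidean length of the real gradient of `ρ` at `z`. -/
def gradNorm {n : ℕ} (ρ : CSpace n → ℝ) (z : CSpace n) : ℝ := ‖gradient ρ z‖

/-- `ρ` is a (global) smooth defining function of `Ω`: on some open neighbourhood `V` of the closure
of `Ω` it is smooth and `Ω = {z ∈ V : ρ(z) < 0}`, and `dρ ≠ 0` on the boundary. The values of `ρ`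
outside `V` are irrelevant; nothing below depends on them. -/
def IsDefiningFunction {n : ℕ} (Ω : Set (CSpace n)) (ρ : CSpace n → ℝ) : Prop :=
  ∃ V : Set (CSpace n), IsOpen V ∧ closure Ω ⊆ V ∧ ContDiffOn ℝ ∞ ρ V ∧
    Ω = {z ∈ V | ρ z < 0} ∧ ∀ z ∈ frontier Ω, fderiv ℝ ρ z ≠ 0

/-- `r` is a smooth local defining function of `Ω` near `p`. -/
def IsLocalDefiningFunction {n : ℕ} (Ω : Set (CSpace n)) (p : CSpace n) (r : CSpace n → ℝ) : Prop :=
  ∃ W : Set (CSpace n), IsOpen W ∧ p ∈ W ∧ ContDiffOn ℝ ∞ r W ∧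
    Ω ∩ W = {z ∈ W | r z < 0} ∧ fderiv ℝ r p ≠ 0

/-- The boundary of `Ω` is smooth: near every boundary point there is a smooth local defining
function. -/
def HasSmoothBoundary {n : ℕ} (Ω : Set (CSpace n)) : Prop :=
  ∀ p ∈ frontier Ω, ∃ r : CSpace n → ℝ, IsLocalDefiningFunction Ω p r

/-- (Levi) pseudoconvexity of a domain with smooth boundary: at every boundary point `p` the Levi
form of a local defining function is positive semidefinite on the `(1,0)` vectors tangent to the
boundary. As is well known, the condition does not depend on the local defining function (two of
them differ by a positive smooth factor), so it is required of all of them. -/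
def IsLeviPseudoconvex {n : ℕ} (Ω : Set (CSpace n)) : Prop :=
  ∀ p ∈ frontier Ω, ∀ r : CSpace n → ℝ, IsLocalDefiningFunction Ω p r →
    ∀ x : CSpace n, holoDeriv x (toComplexFun r) p = 0 → 0 ≤ (leviForm r p x x).re

/-- A (twice continuously differentiable) function is strictly plurisubharmonic on the open set `S`
if its Levi form is positive definite at every point of `S`. -/
def IsStrictlyPlurisubharmonicOn {n : ℕ} (f : CSpace n → ℝ) (S : Set (CSpace n)) : Prop :=
  ContDiffOn ℝ 2 f S ∧ ∀ z ∈ S, ∀ x : CSpace n, x ≠ 0 → 0 < (leviForm f z x x).re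

/-- The Steinness exponent of `ρ`: the infimum of the `η > 1` such that `ρ ^ η` is strictly
plurisubharmonic on `U \ closure Ω` for some neighbourhood `U` of the boundary; it is `∞` if there
is no such `η`. -/
def steinnessExponent {n : ℕ} (Ω : Set (CSpace n)) (ρ : CSpace n → ℝ) : EReal :=
  sInf ((fun η : ℝ => (η : EReal)) '' {η : ℝ | 1 < η ∧
    ∃ U : Set (CSpace n), IsOpen U ∧ frontier Ω ⊆ U ∧
      IsStrictlyPlurisubharmonicOn (fun z => ρ z ^ η) ((closure Ω)ᶜ ∩ U)})

/-- The Steinness index of `Ω`: the infimum of the Steinness exponents of all smooth defining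
functions of `Ω`. -/
def steinnessIndex {n : ℕ} (Ω : Set (CSpace n)) : EReal :=
  ⨅ (ρ : CSpace n → ℝ) (_ : IsDefiningFunction Ω ρ), steinnessExponent Ω ρ

/-- `L` is (the coefficient map of) a smooth `(1,0)` tangent vector field on the boundary of `Ω`,
extended to a smooth `(1,0)` field with `L ρ = 0` on a neighbourhood `U` of the boundary. On the
boundary itself, `L ρ = 0` says exactly that `L` is tangent to it. Zeros of `L` are allowed. -/
def IsTangentField {n : ℕ} (Ω : Set (CSpace n)) (ρ : CSpace n → ℝ) (L : CSpace n → CSpace n) :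
    Prop :=
  ∃ U : Set (CSpace n), IsOpen U ∧ frontier Ω ⊆ U ∧ ContDiffOn ℝ ∞ L U ∧
    ∀ z ∈ U, holoDeriv (L z) (toComplexFun ρ) z = 0

/-- The set of the boundary points at which the Levi form vanishes in the direction `L`. -/
def leviNullSet {n : ℕ} (Ω : Set (CSpace n)) (ρ : CSpace n → ℝ) (L : CSpace n → CSpace n) :
    Set (CSpace n) :=
  {p ∈ frontier Ω | leviForm ρ p (L p) (L p) = 0}

/-- The inequality
`1/(η-1) |Levi(L,N)|² / ‖∇ρ‖² - 1/2 N(Levi(L,L)) / ‖∇ρ‖ ≤ 0` at the point `p`.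
In `N(Levi(L,L))` the function `z ↦ Levi(L,L)(z)` is differentiated along `N`. At the points of
`leviNullSet` this derivative is a real number when `Ω` is pseudoconvex, because `Levi(L,L) ≥ 0` on
the boundary with equality at `p`, and the imaginary part of `N` is tangent to the boundary;
`.re` only turns it into an element of `ℝ`. -/
def LeviInequalityAt {n : ℕ} (ρ : CSpace n → ℝ) (L : CSpace n → CSpace n) (η : ℝ) (p : CSpace n) :
    Prop :=
  1 / (η - 1) * (‖leviForm ρ p (L p) (complexNormal ρ p)‖ ^ 2 / gradNorm ρ p ^ 2)
    - 1 / 2 * ((holoDeriv (complexNormal ρ p) (fun z => leviForm ρ z (L z) (L z)) p).re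
        / gradNorm ρ p) ≤ 0

/-- The infimum of the `η ∈ (1, ∞)` for which the inequality holds at all points of `leviNullSet`,
for all `(1,0)` tangent fields `L`; it is `∞` if there is no such `η`. -/
def boundaryExponent {n : ℕ} (Ω : Set (CSpace n)) (ρ : CSpace n → ℝ) : EReal :=
  sInf ((fun η : ℝ => (η : EReal)) '' {η : ℝ | 1 < η ∧
    ∀ L : CSpace n → CSpace n, IsTangentField Ω ρ L →
      ∀ p ∈ leviNullSet Ω ρ L, LeviInequalityAt ρ L η p})

end

/-! Where `ρ > 0`, the Levi form of `ρ ^ η` is, up to a positive factor, `Q(y) = Levi(y,y) +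
(η-1)/(4ρ) |⟨∇ρ,y⟩|²`. Write `y = t + cN` with `t` tangent to the level set of `ρ`. Near the
boundary, minimizing the resulting quadratic in `c` leaves the form `Levi(t,t) - ρ |Levi(t,N)|² /
w`, with `w` close to `(η-1)/4 ‖∇ρ‖²`. This `reducedForm` is smooth up to the boundary and equals
`Levi(t,t)` there. By `leviInequalityAt_iff`, the boundary inequality for a tangent field `L` says
that the derivative of `reducedForm` on `L` along `N` is nonnegative.

If `ρ ^ η` is strictly plurisubharmonic outside, the reduced form is nonnegative there. At a point
of `leviNullSet` it vanishes, so its outward derivative is nonnegative. Hence `boundaryExponent ≤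
steinnessExponent` for each `ρ`.

Conversely, let the inequality hold with `η`, and let `η' > η`. Pseudoconvexity makes the reduced
form nonnegative on the boundary, and the derivative condition at null vectors then gives `Q(x) > -ε
ρ |x|²` near the boundary for every `ε > 0` (`eventually_forall_powerLeviForm_gt`). Replacing `ρ` by
`ρ exp(ε|z|²)` adds enough positivity to absorb this loss, while the gap `η' - η` absorbs the new
cross terms (`leviForm_rpow_mul_exp_norm_sq_pos`). The defining function changes, so only the infima
over `ρ` are compared. -/

noncomputable section

open Filter Topology

variable {n : ℕ} {F : Type*} [NormedAddCommGroup F] [NormedSpace ℝ F]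

/-- The second derivative of `r`, as a bilinear form. -/
abbrev hess (r : CSpace n → ℝ) (z : CSpace n) : CSpace n →L[ℝ] CSpace n →L[ℝ] ℝ :=
  fderiv ℝ (fderiv ℝ r) z

/-! ### Complex derivatives and the Levi form through real derivatives -/

theorem sum_re_im_single (x : CSpace n) :
    x = ∑ j, ((x j).re • EuclideanSpace.single j (1 : ℂ)
      + (x j).im • EuclideanSpace.single j Complex.I) := by
  ext k
  simp [Pi.single_apply, Finset.sum_add_distrib]

theorem I_smul_sum_re_im_single (x : CSpace n) :
    Complex.I • x = ∑ j, ((x j).re • EuclideanSpace.single j Complex.I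
      - (x j).im • EuclideanSpace.single j (1 : ℂ)) := by
  ext k
  simp [Pi.single_apply, Finset.sum_sub_distrib, Complex.ext_iff]

/-- Contracting the Wirtinger derivatives with `x` extracts the complex-linear part of `A`. This
removes coordinates from all later computations. -/
theorem sum_mul_wirtinger (A : CSpace n →L[ℝ] ℂ) (x : CSpace n) :
    ∑ j, x j * ((1 / 2 : ℂ) * (A (EuclideanSpace.single j 1)
      - Complex.I * A (EuclideanSpace.single j Complex.I)))
      = (1 / 2 : ℂ) * (A x - Complex.I * A (Complex.I • x)) := by
  have h1 := congrArg A (sum_re_im_single x)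
  have h2 := congrArg A (I_smul_sum_re_im_single x)
  simp only [map_sum, map_add, map_sub, map_smul, Complex.real_smul] at h1 h2
  rw [h1, h2, Finset.mul_sum, ← Finset.sum_sub_distrib, Finset.mul_sum]
  refine Finset.sum_congr rfl fun j _ => ?_
  nth_rw 1 [← Complex.re_add_im (x j)]
  linear_combination (1 / 2 : ℂ) * (-(x j).im * A (EuclideanSpace.single j Complex.I)) *
    Complex.I_mul_I

theorem sum_conj_mul_wirtinger (A : CSpace n →L[ℝ] ℂ) (x : CSpace n) :
    ∑ j, (starRingEnd ℂ) (x j) * ((1 / 2 : ℂ) * (A (EuclideanSpace.single j 1)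
      + Complex.I * A (EuclideanSpace.single j Complex.I)))
      = (1 / 2 : ℂ) * (A x + Complex.I * A (Complex.I • x)) := by
  have h1 := congrArg A (sum_re_im_single x)
  have h2 := congrArg A (I_smul_sum_re_im_single x)
  simp only [map_sum, map_add, map_sub, map_smul, Complex.real_smul] at h1 h2
  rw [h1, h2, Finset.mul_sum, ← Finset.sum_add_distrib, Finset.mul_sum]
  refine Finset.sum_congr rfl fun j _ => ?_
  have : (starRingEnd ℂ) (x j) = (x j).re - (x j).im * Complex.I := by
    simp [Complex.ext_iff]
  rw [this]
  linear_combination (1 / 2 : ℂ) * (-(x j).im * A (EuclideanSpace.single j Complex.I)) *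
    Complex.I_mul_I

theorem holoDeriv_eq (x : CSpace n) (f : CSpace n → ℂ) (z : CSpace n) :
    holoDeriv x f z = (1 / 2 : ℂ) * (fderiv ℝ f z x - Complex.I * fderiv ℝ f z (Complex.I • x)) :=
  sum_mul_wirtinger _ _

theorem fderiv_toComplexFun {r : CSpace n → ℝ} {z : CSpace n} (h : DifferentiableAt ℝ r z)
    (v : CSpace n) : fderiv ℝ (toComplexFun r) z v = (fderiv ℝ r z v : ℂ) := by
  have := (Complex.ofRealCLM.hasFDerivAt.comp z h.hasFDerivAt).fderiv
  rw [show toComplexFun r = Complex.ofRealCLM ∘ r from rfl, this]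
  rfl

theorem holoDeriv_toComplexFun {r : CSpace n → ℝ} {z : CSpace n} (h : DifferentiableAt ℝ r z)
    (x : CSpace n) : holoDeriv x (toComplexFun r) z
      = (1 / 2 : ℂ) * (fderiv ℝ r z x - Complex.I * fderiv ℝ r z (Complex.I • x)) := by
  rw [holoDeriv_eq, fderiv_toComplexFun h, fderiv_toComplexFun h]

theorem dzbar_toComplexFun {r : CSpace n → ℝ} {z : CSpace n} (h : DifferentiableAt ℝ r z)
    (k : Fin n) : dzbar k (toComplexFun r) z
      = (1 / 2 : ℂ) * (fderiv ℝ r z (EuclideanSpace.single k 1)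
        + Complex.I * fderiv ℝ r z (EuclideanSpace.single k Complex.I)) := by
  rw [dzbar, fderiv_toComplexFun h, fderiv_toComplexFun h]

theorem dz_toComplexFun {r : CSpace n → ℝ} {z : CSpace n} (h : DifferentiableAt ℝ r z)
    (k : Fin n) : dz k (toComplexFun r) z = (starRingEnd ℂ) (dzbar k (toComplexFun r) z) := by
  rw [dzbar_toComplexFun h, dz, fderiv_toComplexFun h, fderiv_toComplexFun h]
  simp [Complex.ext_iff]

theorem hasFDerivAt_fderiv_apply {r : CSpace n → ℝ} {z : CSpace n} (h : ContDiffAt ℝ 2 r z)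
    (v : CSpace n) : HasFDerivAt (fun w => fderiv ℝ r w v) ((hess r z).flip v) z := by
  have h1 : DifferentiableAt ℝ (fderiv ℝ r) z :=
    (h.fderiv_right (m := 1) (by norm_num)).differentiableAt (by norm_num)
  exact h1.hasFDerivAt.clm_apply (hasFDerivAt_const v z) |>.congr_fderiv (by ext; simp)

theorem eventually_differentiableAt {r : CSpace n → ℝ} {z : CSpace n} (h : ContDiffAt ℝ 2 r z) :
    ∀ᶠ w in 𝓝 z, DifferentiableAt ℝ r w :=
  (h.eventually (by simp)).mono fun _ hw => hw.differentiableAt (by simp)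

theorem fderiv_dzbar {r : CSpace n → ℝ} {z : CSpace n} (h : ContDiffAt ℝ 2 r z)
    (k : Fin n) (v : CSpace n) : fderiv ℝ (dzbar k (toComplexFun r)) z v
      = (1 / 2 : ℂ) * (hess r z v (EuclideanSpace.single k 1)
        + Complex.I * hess r z v (EuclideanSpace.single k Complex.I)) := by
  have e : dzbar k (toComplexFun r) =ᶠ[𝓝 z] fun w =>
      (1 / 2 : ℂ) * (Complex.ofRealCLM (fderiv ℝ r w (EuclideanSpace.single k 1))
        + Complex.I * Complex.ofRealCLM (fderiv ℝ r w (EuclideanSpace.single k Complex.I))) :=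
    (eventually_differentiableAt h).mono fun w hw => dzbar_toComplexFun hw k
  have h1 := Complex.ofRealCLM.hasFDerivAt.comp z
    (hasFDerivAt_fderiv_apply h (EuclideanSpace.single k 1))
  have h2 := Complex.ofRealCLM.hasFDerivAt.comp z
    (hasFDerivAt_fderiv_apply h (EuclideanSpace.single k Complex.I))
  have h3 := (h1.add (h2.const_mul Complex.I)).const_mul (1 / 2 : ℂ)
  rw [e.fderiv_eq]
  erw [h3.fderiv]
  simp [mul_add]

/-- Contract first over `j`, then over `k`, with the two Wirtinger identities. Symmetry and
smoothness questions thereby pass to the real Hessian. -/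
theorem leviForm_eq {r : CSpace n → ℝ} {z : CSpace n} (h : ContDiffAt ℝ 2 r z) (x y : CSpace n) :
    leviForm r z x y = (1 / 4 : ℂ) * ((hess r z x y + hess r z (Complex.I • x) (Complex.I • y))
      + Complex.I * (hess r z x (Complex.I • y) - hess r z (Complex.I • x) y)) := by
  have h1 : ∀ k, ∑ j, x j * dz j (dzbar k (toComplexFun r)) z =
      (1 / 2 : ℂ) * ((1 / 2 : ℂ) * (hess r z x (EuclideanSpace.single k 1)
        + Complex.I * hess r z x (EuclideanSpace.single k Complex.I))
      - Complex.I * ((1 / 2 : ℂ) * (hess r z (Complex.I • x) (EuclideanSpace.single k 1)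
        + Complex.I * hess r z (Complex.I • x) (EuclideanSpace.single k Complex.I)))) := fun k => by
    rw [← fderiv_dzbar h, ← fderiv_dzbar h]
    exact sum_mul_wirtinger _ _
  have h2 := sum_conj_mul_wirtinger (Complex.ofRealCLM.comp (hess r z x)) y
  have h3 := sum_conj_mul_wirtinger (Complex.ofRealCLM.comp (hess r z (Complex.I • x))) y
  simp only [ContinuousLinearMap.comp_apply, Complex.ofRealCLM_apply] at h2 h3
  have h4 : leviForm r z x y = ∑ k, (starRingEnd ℂ) (y k) *
      ∑ j, x j * dz j (dzbar k (toComplexFun r)) z := by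
    rw [leviForm, Finset.sum_comm]
    simp only [Finset.mul_sum]
    exact Finset.sum_congr rfl fun k _ => Finset.sum_congr rfl fun j _ => by ring
  simp only [h4, h1]
  have h5 : ∀ a b e : Fin n → ℂ, ∑ k, e k * ((1 / 2 : ℂ) * (a k - Complex.I * b k))
      = (1 / 2 : ℂ) * (∑ k, e k * a k - Complex.I * ∑ k, e k * b k) := fun a b e => by
    simp only [Finset.mul_sum, ← Finset.sum_sub_distrib]
    exact Finset.sum_congr rfl fun k _ => by ring
  rw [h5, h2, h3]
  linear_combination (-1 / 4 : ℂ) * hess r z (Complex.I • x) (Complex.I • y) * Complex.I_mul_I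

theorem hess_symm {r : CSpace n → ℝ} {z : CSpace n} (h : ContDiffAt ℝ 2 r z) (x y : CSpace n) :
    hess r z x y = hess r z y x :=
  h.isSymmSndFDerivAt (by simp) |>.eq x y

theorem leviForm_conj {r : CSpace n → ℝ} {z : CSpace n} (h : ContDiffAt ℝ 2 r z)
    (x y : CSpace n) : leviForm r z y x = (starRingEnd ℂ) (leviForm r z x y) := by
  rw [leviForm_eq h, leviForm_eq h, hess_symm h y x, hess_symm h (Complex.I • y),
    hess_symm h (Complex.I • y) x, hess_symm h y]
  simp [Complex.ext_iff]

theorem leviForm_self_im {r : CSpace n → ℝ} {z : CSpace n} (h : ContDiffAt ℝ 2 r z)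
    (x : CSpace n) : (leviForm r z x x).im = 0 :=
  Complex.conj_eq_iff_im.1 (leviForm_conj h x x).symm

theorem leviForm_self_re {r : CSpace n → ℝ} {z : CSpace n} (h : ContDiffAt ℝ 2 r z)
    (x : CSpace n) : (leviForm r z x x).re
      = (1 / 4) * (hess r z x x + hess r z (Complex.I • x) (Complex.I • x)) := by
  rw [leviForm_eq h, hess_symm h (Complex.I • x) x]
  simp

theorem leviForm_add_smul (r : CSpace n → ℝ) (z x y : CSpace n) (c : ℂ) :
    leviForm r z (x + c • y) (x + c • y) = leviForm r z x x
      + (starRingEnd ℂ) c * leviForm r z x y + c * leviForm r z y x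
      + c * (starRingEnd ℂ) c * leviForm r z y y := by
  simp only [leviForm, Finset.mul_sum, ← Finset.sum_add_distrib]
  refine Finset.sum_congr rfl fun j _ => Finset.sum_congr rfl fun k _ => ?_
  simp
  ring

theorem leviForm_self_add_smul_re {r : CSpace n → ℝ} {z : CSpace n} (h : ContDiffAt ℝ 2 r z)
    (x y : CSpace n) (c : ℂ) : (leviForm r z (x + c • y) (x + c • y)).re
      = (leviForm r z x x).re + 2 * ((starRingEnd ℂ) c * leviForm r z x y).re
        + ‖c‖ ^ 2 * (leviForm r z y y).re := by
  rw [leviForm_add_smul, leviForm_conj h x y, Complex.mul_conj, Complex.normSq_eq_norm_sq]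
  simp only [Complex.add_re, Complex.mul_re, Complex.conj_re, Complex.conj_im, Complex.ofReal_re,
    Complex.ofReal_im]
  ring

/-! ### The gradient, the complex normal and smooth dependence -/

theorem gradient_eq_dzbar {r : CSpace n → ℝ} {z : CSpace n} (h : DifferentiableAt ℝ r z)
    (j : Fin n) : gradient r z j = 2 * dzbar j (toComplexFun r) z := by
  have key : ∀ v, fderiv ℝ r z v = inner ℝ (gradient r z) v := fun v => by
    rw [gradient, InnerProductSpace.toDual_symm_apply]
  rw [dzbar_toComplexFun h, key, key]
  generalize gradient r z = g
  simp [PiLp.inner_apply, apply_ite, Complex.ext_iff]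

theorem holoDeriv_eq_inner {r : CSpace n → ℝ} {z : CSpace n} (h : DifferentiableAt ℝ r z)
    (x : CSpace n) : holoDeriv x (toComplexFun r) z = (1 / 2 : ℂ) * inner ℂ (gradient r z) x := by
  simp only [holoDeriv, PiLp.inner_apply, gradient_eq_dzbar h, dz_toComplexFun h,
    RCLike.inner_apply, map_mul, Finset.mul_sum]
  refine Finset.sum_congr rfl fun j _ => ?_
  rw [Complex.conj_ofNat]
  ring

theorem complexNormal_eq {r : CSpace n → ℝ} {z : CSpace n} (h : DifferentiableAt ℝ r z) :
    complexNormal r z = ((‖gradient r z‖⁻¹ : ℝ) : ℂ) • gradient r z := by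
  have h1 : Real.sqrt (∑ k, ‖dz k (toComplexFun r) z‖ ^ 2) = ‖gradient r z‖ / 2 := by
    rw [EuclideanSpace.norm_eq, Real.sqrt_eq_iff_mul_self_eq (by positivity) (by positivity)]
    rw [div_mul_div_comm, Real.mul_self_sqrt (by positivity), Finset.sum_div]
    refine Finset.sum_congr rfl fun j _ => ?_
    rw [gradient_eq_dzbar h, dz_toComplexFun h, RCLike.norm_conj, norm_mul]
    norm_num
    ring
  ext j
  simp only [complexNormal, h1, PiLp.smul_apply, gradient_eq_dzbar h, smul_eq_mul]
  push_cast
  field_simp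

theorem ContDiffAt.two_of_infty {r : CSpace n → ℝ} {z : CSpace n} (h : ContDiffAt ℝ ∞ r z) :
    ContDiffAt ℝ 2 r z :=
  h.of_le (WithTop.coe_le_coe.2 le_top)

theorem ContDiffAt.gradient_infty {r : CSpace n → ℝ} {z : CSpace n} (h : ContDiffAt ℝ ∞ r z) :
    ContDiffAt ℝ ∞ (gradient r) z := by
  have h1 : ContDiffAt ℝ ∞ (fderiv ℝ r) z := h.fderiv_right (by simp)
  rw [contDiffAt_piLp]
  intro j
  have h2 : (fun w => gradient r w j) =ᶠ[𝓝 z] fun w =>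
      Complex.ofRealCLM (fderiv ℝ r w (EuclideanSpace.single j 1))
        + Complex.I * Complex.ofRealCLM (fderiv ℝ r w (EuclideanSpace.single j Complex.I)) := by
    filter_upwards [eventually_differentiableAt h.two_of_infty] with w hw
    rw [gradient_eq_dzbar hw, dzbar_toComplexFun hw]
    simp
  refine ContDiffAt.congr_of_eventuallyEq ?_ h2
  have h3 : ∀ v, ContDiffAt ℝ ∞ (fun w => Complex.ofRealCLM (fderiv ℝ r w v)) z := fun v =>
    Complex.ofRealCLM.contDiff.contDiffAt.comp z (h1.clm_apply contDiffAt_const)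
  exact (h3 _).add (contDiffAt_const.mul (h3 _))

theorem ContDiffAt.leviForm {r : CSpace n → ℝ} {f a b : F → CSpace n} {q : F}
    (h : ContDiffAt ℝ ∞ r (f q)) (hf : ContDiffAt ℝ ∞ f q) (ha : ContDiffAt ℝ ∞ a q)
    (hb : ContDiffAt ℝ ∞ b q) : ContDiffAt ℝ ∞ (fun t => leviForm r (f t) (a t) (b t)) q := by
  have h1 : ContDiffAt ℝ ∞ (hess r) (f q) := (h.fderiv_right (m := ∞) (by simp)).fderiv_right
    (by simp)
  have h2 : ∀ᶠ t in 𝓝 q, ContDiffAt ℝ 2 r (f t) :=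
    hf.continuousAt.eventually (h.two_of_infty.eventually (by simp))
  have h3 : ∀ {c d : F → CSpace n}, ContDiffAt ℝ ∞ c q → ContDiffAt ℝ ∞ d q →
      ContDiffAt ℝ ∞ (fun t => Complex.ofRealCLM (hess r (f t) (c t) (d t))) q := fun hc hd =>
    Complex.ofRealCLM.contDiff.contDiffAt.comp q (((h1.comp q hf).clm_apply hc).clm_apply hd)
  have hIa : ContDiffAt ℝ ∞ (fun t => Complex.I • a t) q := ha.const_smul _
  have hIb : ContDiffAt ℝ ∞ (fun t => Complex.I • b t) q := hb.const_smul _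
  refine ContDiffAt.congr_of_eventuallyEq ?_ (h2.mono fun t ht => leviForm_eq ht (a t) (b t))
  exact contDiffAt_const.mul (((h3 ha hb).add (h3 hIa hIb)).add
    (contDiffAt_const.mul ((h3 ha hIb).sub (h3 hIa hb))))

/-- The component of `y` which is orthogonal to the gradient of `r` at `z`. -/
def tangentPart (r : CSpace n → ℝ) (z y : CSpace n) : CSpace n :=
  y - ((inner ℂ (gradient r z) y : ℂ) / ((‖gradient r z‖ ^ 2 : ℝ) : ℂ)) • gradient r z

theorem ContDiffAt.tangentPart {r : CSpace n → ℝ} {f a : F → CSpace n} {q : F}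
    (h : ContDiffAt ℝ ∞ r (f q)) (h0 : gradient r (f q) ≠ 0) (hf : ContDiffAt ℝ ∞ f q)
    (ha : ContDiffAt ℝ ∞ a q) : ContDiffAt ℝ ∞ (fun t => tangentPart r (f t) (a t)) q := by
  have h1 : ContDiffAt ℝ ∞ (fun t => gradient r (f t)) q := h.gradient_infty.comp q hf
  have h2 : ContDiffAt ℝ ∞ (fun t => ((‖gradient r (f t)‖ ^ 2 : ℝ) : ℂ)) q :=
    Complex.ofRealCLM.contDiff.contDiffAt.comp q (h1.norm_sq ℂ)
  have h3 : ((‖gradient r (f q)‖ ^ 2 : ℝ) : ℂ) ≠ 0 := by simpa using h0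
  have h4 := ((h1.inner ℂ ha).mul (h2.inv h3)).smul h1
  exact ha.sub h4

theorem ContDiffAt.complexNormal {r : CSpace n → ℝ} {z : CSpace n}
    (h : ContDiffAt ℝ ∞ r z) (h0 : gradient r z ≠ 0) :
    ContDiffAt ℝ ∞ (complexNormal r) z := by
  have h1 := h.gradient_infty
  refine ContDiffAt.congr_of_eventuallyEq ?_
    ((eventually_differentiableAt h.two_of_infty).mono
      fun w hw => complexNormal_eq hw)
  exact (Complex.ofRealCLM.contDiff.contDiffAt.comp z
    ((h1.norm ℂ h0).inv (by simpa using h0))).smul h1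

/-- The imaginary part of `f` must vanish near `z`, not only at `z`, for it to drop out of the
derivative; this holds for `Levi(L,L)`. -/
theorem holoDeriv_re_of_im_eq_zero {f : CSpace n → ℂ} {z : CSpace n} (h : DifferentiableAt ℝ f z)
    (h0 : ∀ᶠ w in 𝓝 z, (f w).im = 0) (x : CSpace n) :
    (holoDeriv x f z).re = (1 / 2) * fderiv ℝ (fun w => (f w).re) z x := by
  have h1 : f =ᶠ[𝓝 z] toComplexFun fun w => (f w).re :=
    h0.mono fun w hw => by simp [toComplexFun, Complex.ext_iff, hw]
  have h2 : DifferentiableAt ℝ (fun w => (f w).re) z := Complex.reCLM.differentiableAt.comp z h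
  rw [holoDeriv_eq, h1.fderiv_eq, fderiv_toComplexFun h2, fderiv_toComplexFun h2]
  simp

/-! ### Levi forms of powers -/

theorem hess_comp_self {φ : ℝ → ℝ} {f : CSpace n → ℝ} {z : CSpace n}
    (hφ : ContDiffAt ℝ 2 φ (f z)) (hf : ContDiffAt ℝ 2 f z) (v : CSpace n) :
    hess (fun w => φ (f w)) z v v
      = deriv (deriv φ) (f z) * fderiv ℝ f z v ^ 2 + deriv φ (f z) * hess f z v v := by
  have h1 : fderiv ℝ (fun w => φ (f w)) =ᶠ[𝓝 z] fun w => deriv φ (f w) • fderiv ℝ f w := by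
    filter_upwards [eventually_differentiableAt hf,
      hf.continuousAt.eventually (hφ.eventually (by simp))] with w hw hw'
    exact ((hw'.differentiableAt (by simp)).hasDerivAt.comp_hasFDerivAt w hw.hasFDerivAt).fderiv
  have h2 : DifferentiableAt ℝ (fderiv ℝ f) z :=
    (hf.fderiv_right (m := 1) (by norm_num)).differentiableAt (by norm_num)
  have h3 : DifferentiableAt ℝ (deriv φ) (f z) := by
    have : DifferentiableAt ℝ (fderiv ℝ φ) (f z) :=
      (hφ.fderiv_right (m := 1) (by norm_num)).differentiableAt (by norm_num)
    exact this.clm_apply (differentiableAt_const _)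
  have h4 := (h3.hasDerivAt.comp_hasFDerivAt z (hf.differentiableAt (by simp)).hasFDerivAt).smul
    h2.hasFDerivAt
  rw [hess, h1.fderiv_eq]
  erw [h4.fderiv]
  simp
  ring

theorem contDiffAt_rpow_mul_exp {r ψ : CSpace n → ℝ} {z : CSpace n} (η : ℝ)
    (hr : ContDiffAt ℝ 2 r z) (hψ : ContDiffAt ℝ 2 ψ z) (h0 : 0 < r z) :
    ContDiffAt ℝ 2 (fun w => (r w * Real.exp (ψ w)) ^ η) z :=
  (hr.mul hψ.exp).rpow_const_of_ne (by positivity)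

/-- Near `z` the function is `exp u` with `u = η (log r + ψ)`. The negative squares come from the
Hessian of `log r`, the positive ones from the square of `du`. -/
theorem leviForm_rpow_mul_exp {r ψ : CSpace n → ℝ} {z : CSpace n} (η : ℝ)
    (hr : ContDiffAt ℝ 2 r z) (hψ : ContDiffAt ℝ 2 ψ z) (h0 : 0 < r z) (x : CSpace n) :
    4 * (leviForm (fun w => (r w * Real.exp (ψ w)) ^ η) z x x).re
      = η * (r z * Real.exp (ψ z)) ^ η *
        ((hess r z x x + hess r z (Complex.I • x) (Complex.I • x)) / r z
        + (hess ψ z x x + hess ψ z (Complex.I • x) (Complex.I • x))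
        - (fderiv ℝ r z x / r z) ^ 2 - (fderiv ℝ r z (Complex.I • x) / r z) ^ 2
        + η * (fderiv ℝ r z x / r z + fderiv ℝ ψ z x) ^ 2
        + η * (fderiv ℝ r z (Complex.I • x) / r z + fderiv ℝ ψ z (Complex.I • x)) ^ 2) := by
  have hlog : ContDiffAt ℝ 2 (fun w => Real.log (r w)) z := hr.log h0.ne'
  set u : CSpace n → ℝ := fun w => η * (Real.log (r w) + ψ w)
  have hu : ContDiffAt ℝ 2 u z := contDiffAt_const.mul (hlog.add hψ)
  have hd_log : ∀ w, ContDiffAt ℝ 2 r w → 0 < r w →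
      fderiv ℝ (fun w => Real.log (r w)) w = (r w)⁻¹ • fderiv ℝ r w := fun w hw hw0 =>
    ((hw.differentiableAt (by simp)).hasFDerivAt.log hw0.ne').fderiv
  have hdu : ∀ᶠ w in 𝓝 z, fderiv ℝ u w
      = η • (fderiv ℝ (fun w => Real.log (r w)) w + fderiv ℝ ψ w) := by
    filter_upwards [eventually_differentiableAt hlog, eventually_differentiableAt hψ] with w h1 h2
    exact ((h1.hasFDerivAt.add h2.hasFDerivAt).const_mul η).fderiv
  have hhu : ∀ v, hess u z v v = η * (-(fderiv ℝ r z v / r z) ^ 2 + hess r z v v / r z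
      + hess ψ z v v) := fun v => by
    have hdiff : ∀ {f : CSpace n → ℝ}, ContDiffAt ℝ 2 f z → DifferentiableAt ℝ (fderiv ℝ f) z :=
      fun hf => (hf.fderiv_right (m := 1) (by norm_num)).differentiableAt (by norm_num)
    have h1 : hess u z = η • (hess (fun w => Real.log (r w)) z + hess ψ z) := by
      rw [hess, Filter.EventuallyEq.fderiv_eq hdu]
      exact (((hdiff hlog).hasFDerivAt.add (hdiff hψ).hasFDerivAt).const_smul η).fderiv
    have h2 := hess_comp_self (φ := Real.log) (Real.contDiffAt_log.2 h0.ne') hr v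
    rw [h1]
    simp only [smul_apply, add_apply, h2, smul_eq_mul]
    simp only [Real.deriv_log', deriv_inv]
    ring
  have hduv : ∀ v, fderiv ℝ u z v = η * (fderiv ℝ r z v / r z + fderiv ℝ ψ z v) := fun v => by
    rw [hdu.self_of_nhds, hd_log z hr h0]
    simp
    ring
  have hF : (fun w => (r w * Real.exp (ψ w)) ^ η) =ᶠ[𝓝 z] fun w => Real.exp (u w) := by
    filter_upwards [hr.continuousAt.eventually (lt_mem_nhds h0)] with w hw
    rw [Real.rpow_def_of_pos (by positivity), Real.log_mul hw.ne' (Real.exp_ne_zero _),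
      Real.log_exp, mul_comm]
  have hh : ∀ v, hess (fun w => (r w * Real.exp (ψ w)) ^ η) z v v
      = Real.exp (u z) * fderiv ℝ u z v ^ 2 + Real.exp (u z) * hess u z v v := fun v => by
    rw [hess, hF.fderiv.fderiv_eq, ← hess, hess_comp_self Real.contDiff_exp.contDiffAt hu]
    simp
  rw [leviForm_self_re (contDiffAt_rpow_mul_exp η hr hψ h0), hh, hh, hhu, hhu, hduv, hduv,
    show (r z * Real.exp (ψ z)) ^ η = Real.exp (u z) from hF.self_of_nhds]
  ring

/-! ### Normal and tangential components -/

theorem gradient_ne_zero_iff {r : CSpace n → ℝ} {z : CSpace n} :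
    gradient r z ≠ 0 ↔ fderiv ℝ r z ≠ 0 := by
  rw [gradient, ne_eq, EmbeddingLike.map_eq_zero_iff]

theorem fderiv_eq_inner_gradient (r : CSpace n → ℝ) (z v : CSpace n) :
    fderiv ℝ r z v = inner ℝ (gradient r z) v := by
  rw [gradient, InnerProductSpace.toDual_symm_apply]

theorem norm_inner_gradient_sq {r : CSpace n → ℝ} {z : CSpace n} (h : DifferentiableAt ℝ r z)
    (x : CSpace n) : ‖(inner ℂ (gradient r z) x : ℂ)‖ ^ 2
      = fderiv ℝ r z x ^ 2 + fderiv ℝ r z (Complex.I • x) ^ 2 := by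
  have h1 : (inner ℂ (gradient r z) x : ℂ)
      = fderiv ℝ r z x - Complex.I * fderiv ℝ r z (Complex.I • x) := by
    have := (holoDeriv_eq_inner h x).symm.trans (holoDeriv_toComplexFun h x)
    exact mul_left_cancel₀ (by norm_num) this
  rw [h1, ← Complex.normSq_eq_norm_sq, Complex.normSq_apply]
  simp
  ring

theorem inner_gradient_complexNormal {r : CSpace n → ℝ} {z : CSpace n}
    (h : DifferentiableAt ℝ r z) (h0 : gradient r z ≠ 0) :
    (inner ℂ (gradient r z) (complexNormal r z) : ℂ) = (‖gradient r z‖ : ℂ) := by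
  have : (‖gradient r z‖ : ℂ) ≠ 0 := by simpa using h0
  rw [complexNormal_eq h, inner_smul_right, inner_self_eq_norm_sq_to_K]
  push_cast
  field_simp
  rfl

theorem norm_complexNormal {r : CSpace n → ℝ} {z : CSpace n}
    (h : DifferentiableAt ℝ r z) (h0 : gradient r z ≠ 0) : ‖complexNormal r z‖ = 1 := by
  rw [complexNormal_eq h, norm_smul, Complex.norm_real, norm_inv, norm_norm]
  exact inv_mul_cancel₀ (norm_ne_zero_iff.2 h0)

theorem fderiv_complexNormal {r : CSpace n → ℝ} {z : CSpace n}
    (h : DifferentiableAt ℝ r z) (h0 : gradient r z ≠ 0) :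
    fderiv ℝ r z (complexNormal r z) = ‖gradient r z‖ := by
  rw [fderiv_eq_inner_gradient, complexNormal_eq h, Complex.coe_smul, real_inner_smul_right,
    real_inner_self_eq_norm_sq]
  have := norm_ne_zero_iff.2 h0
  field_simp

theorem inner_gradient_tangentPart {r : CSpace n → ℝ} {z : CSpace n} (h0 : gradient r z ≠ 0)
    (y : CSpace n) : (inner ℂ (gradient r z) (tangentPart r z y) : ℂ) = 0 := by
  have : (‖gradient r z‖ : ℂ) ≠ 0 := by simpa using h0
  rw [tangentPart, inner_sub_right, inner_smul_right, inner_self_eq_norm_sq_to_K]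
  push_cast
  field_simp
  simp

theorem tangentPart_eq_self {r : CSpace n → ℝ} {z y : CSpace n}
    (h : (inner ℂ (gradient r z) y : ℂ) = 0) : tangentPart r z y = y := by
  simp [tangentPart, h]

theorem tangentPart_add_complexNormal {r : CSpace n → ℝ} {z : CSpace n}
    (h : DifferentiableAt ℝ r z) (h0 : gradient r z ≠ 0) (y : CSpace n) :
    ∃ c : ℂ, y = tangentPart r z y + c • complexNormal r z := by
  have : (‖gradient r z‖ : ℂ) ≠ 0 := by simpa using h0
  refine ⟨(inner ℂ (gradient r z) y : ℂ) / ‖gradient r z‖, ?_⟩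
  rw [tangentPart, complexNormal_eq h, smul_smul]
  have : (inner ℂ (gradient r z) y : ℂ) / ‖gradient r z‖ * ((‖gradient r z‖⁻¹ : ℝ) : ℂ)
      = (inner ℂ (gradient r z) y : ℂ) / ((‖gradient r z‖ ^ 2 : ℝ) : ℂ) := by
    push_cast
    field_simp
  rw [this, sub_add_cancel]

/-! ### Minimizing over the normal component -/

/-- The Levi form of `r ^ η` at `z`, divided by `η * r ^ (η - 1)`. -/
def powerLeviForm (r : CSpace n → ℝ) (η : ℝ) (z y : CSpace n) : ℝ :=
  (leviForm r z y y).re + (η - 1) / (4 * r z) * ‖(inner ℂ (gradient r z) y : ℂ)‖ ^ 2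

theorem powerLeviForm_smul (r : CSpace n → ℝ) (η : ℝ) (z y : CSpace n) (c : ℝ) :
    powerLeviForm r η z ((c : ℂ) • y) = c ^ 2 * powerLeviForm r η z y := by
  have : leviForm r z ((c : ℂ) • y) ((c : ℂ) • y) = ((c ^ 2 : ℝ) : ℂ) * leviForm r z y y := by
    simp only [leviForm, Finset.mul_sum]
    refine Finset.sum_congr rfl fun j _ => Finset.sum_congr rfl fun k _ => ?_
    simp
    ring
  rw [powerLeviForm, powerLeviForm, this, Complex.re_ofReal_mul, inner_smul_right, norm_mul,
    mul_pow, Complex.norm_real, Real.norm_eq_abs, sq_abs]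
  ring

/-- `r` times the value of `powerLeviForm` on the complex normal. -/
def normalWeight (r : CSpace n → ℝ) (η : ℝ) (z : CSpace n) : ℝ :=
  (η - 1) / 4 * ‖gradient r z‖ ^ 2
    + r z * (leviForm r z (complexNormal r z) (complexNormal r z)).re

/-- The minimum of `powerLeviForm` over all vectors with tangential part `t`. -/
def reducedForm (r : CSpace n → ℝ) (η : ℝ) (z t : CSpace n) : ℝ :=
  (leviForm r z t t).re - r z * (‖leviForm r z t (complexNormal r z)‖ ^ 2 * (normalWeight r η z)⁻¹)

theorem powerLeviForm_add_smul {r : CSpace n → ℝ} {η : ℝ} {z t : CSpace n}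
    (h : ContDiffAt ℝ 2 r z) (h0 : gradient r z ≠ 0) (hr : 0 < r z)
    (ht : (inner ℂ (gradient r z) t : ℂ) = 0) (c : ℂ) :
    powerLeviForm r η z (t + c • complexNormal r z) = (leviForm r z t t).re
      + 2 * ((starRingEnd ℂ) c * leviForm r z t (complexNormal r z)).re
      + ‖c‖ ^ 2 * normalWeight r η z / r z := by
  have hd := h.differentiableAt (by simp)
  rw [powerLeviForm, leviForm_self_add_smul_re h, inner_add_right, ht, inner_smul_right,
    inner_gradient_complexNormal hd h0, zero_add, norm_mul, Complex.norm_real, norm_norm,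
    normalWeight]
  field_simp
  ring

theorem exists_powerLeviForm_eq_reducedForm {r : CSpace n → ℝ} {η : ℝ} {z t : CSpace n}
    (h : ContDiffAt ℝ 2 r z) (h0 : gradient r z ≠ 0) (hr : 0 < r z)
    (ht : (inner ℂ (gradient r z) t : ℂ) = 0) (hw : 0 < normalWeight r η z) :
    ∃ y, powerLeviForm r η z y = reducedForm r η z t := by
  set d := leviForm r z t (complexNormal r z) with hd
  -- With `d = Levi(t,N)` and `w` the normal weight, `2 Re(c̄ d) + |c|² w / r` is minimal at `c =
  -- -(r/w) d`.
  refine ⟨t + (((-(r z / normalWeight r η z) : ℝ) : ℂ) * d) • complexNormal r z, ?_⟩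
  have h1 : (starRingEnd ℂ) (((-(r z / normalWeight r η z) : ℝ) : ℂ) * d) * d
      = ((-(r z / normalWeight r η z) * ‖d‖ ^ 2 : ℝ) : ℂ) := by
    rw [map_mul, Complex.conj_ofReal, mul_assoc, mul_comm _ d, Complex.mul_conj,
      Complex.normSq_eq_norm_sq]
    push_cast
    ring
  rw [powerLeviForm_add_smul h h0 hr ht, ← hd, h1, Complex.ofReal_re, norm_mul, Complex.norm_real,
    mul_pow, Real.norm_eq_abs, sq_abs, reducedForm, ← hd]
  field_simp
  ring

/-- Bound `Re(c̄ d)` below by `-|c| |d|` and complete the square in `|c|`. -/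
theorem reducedForm_le_powerLeviForm {r : CSpace n → ℝ} {η : ℝ} {z : CSpace n}
    (h : ContDiffAt ℝ 2 r z) (h0 : gradient r z ≠ 0) (hr : 0 < r z)
    (hw : 0 < normalWeight r η z) (y : CSpace n) :
    reducedForm r η z (tangentPart r z y) ≤ powerLeviForm r η z y := by
  obtain ⟨c, hc⟩ := tangentPart_add_complexNormal (h.differentiableAt (by simp)) h0 y
  conv_rhs => rw [hc]
  rw [powerLeviForm_add_smul h h0 hr (inner_gradient_tangentPart h0 y), reducedForm]
  set d := leviForm r z (tangentPart r z y) (complexNormal r z)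
  have h1 : -(‖c‖ * ‖d‖) ≤ ((starRingEnd ℂ) c * d).re := by
    have := Complex.abs_re_le_norm ((starRingEnd ℂ) c * d)
    rw [norm_mul, RCLike.norm_conj] at this
    exact (abs_le.1 this).1
  have h2 : 0 ≤ normalWeight r η z / r z * (‖c‖ - r z * ‖d‖ * (normalWeight r η z)⁻¹) ^ 2 := by
    positivity
  have h3 : normalWeight r η z / r z * (‖c‖ - r z * ‖d‖ * (normalWeight r η z)⁻¹) ^ 2
      = ‖c‖ ^ 2 * normalWeight r η z / r z - 2 * (‖c‖ * ‖d‖)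
        + r z * (‖d‖ ^ 2 * (normalWeight r η z)⁻¹) := by
    field_simp
    ring
  linarith

/-- The factor `r` built into the weight removes the Levi term of unknown sign at the boundary. By
continuity the weight stays positive nearby. -/
theorem normalWeight_pos {r : CSpace n → ℝ} {η : ℝ} {p : CSpace n} (h0 : gradient r p ≠ 0)
    (hr : r p = 0) (hη : 1 < η) : 0 < normalWeight r η p := by
  have := norm_pos_iff.2 h0
  rw [normalWeight, hr, zero_mul, add_zero]
  have : 0 < η - 1 := by linarith
  positivity

theorem contDiffAt_normalWeight {r : CSpace n → ℝ} {p : CSpace n} (η : ℝ)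
    (h : ContDiffAt ℝ ∞ r p) (h0 : gradient r p ≠ 0) : ContDiffAt ℝ ∞ (normalWeight r η) p :=
  (contDiffAt_const.mul (h.gradient_infty.norm_sq ℂ)).add
    (h.mul (Complex.reCLM.contDiff.contDiffAt.comp p
      (h.leviForm contDiffAt_id (h.complexNormal h0) (h.complexNormal h0))))

theorem contDiffAt_reducedForm {r : CSpace n → ℝ} {η : ℝ} {f t : F → CSpace n} {q : F}
    (h : ContDiffAt ℝ ∞ r (f q)) (h0 : gradient r (f q) ≠ 0) (hw : normalWeight r η (f q) ≠ 0)
    (hf : ContDiffAt ℝ ∞ f q) (ht : ContDiffAt ℝ ∞ t q) :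
    ContDiffAt ℝ ∞ (fun s => reducedForm r η (f s) (t s)) q := by
  have h1 := h.leviForm hf ht ht
  have h2 := h.leviForm hf ht ((h.complexNormal h0).comp q hf)
  exact (Complex.reCLM.contDiff.contDiffAt.comp q h1).sub ((h.comp q hf).mul
    ((h2.norm_sq ℂ).mul (((contDiffAt_normalWeight η h h0).comp q hf).inv hw)))

/-- As `r p = 0`, the product rule leaves only `dr(N) = ‖∇r‖` times the correction `|Levi(L,N)|² /
w`. The two inequalities then differ by the positive factor `4 ‖∇r‖`. -/
theorem leviInequalityAt_iff {r : CSpace n → ℝ} {L : CSpace n → CSpace n} {η : ℝ} {p : CSpace n}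
    (h : ContDiffAt ℝ ∞ r p) (h0 : gradient r p ≠ 0) (hr : r p = 0) (hη : 1 < η)
    (hL : ContDiffAt ℝ ∞ L p) :
    LeviInequalityAt r L η p ↔
      0 ≤ fderiv ℝ (fun z => reducedForm r η z (L z)) p (complexNormal r p) := by
  have hd := h.two_of_infty.differentiableAt (by simp)
  have ha := norm_pos_iff.2 h0
  have hw := normalWeight_pos h0 hr hη
  have h1 : ContDiffAt ℝ ∞ (fun z => leviForm r z (L z) (L z)) p := h.leviForm contDiffAt_id hL hL
  have h2 : ContDiffAt ℝ ∞ (fun z => ‖leviForm r z (L z) (complexNormal r z)‖ ^ 2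
      * (normalWeight r η z)⁻¹) p :=
    ((h.leviForm contDiffAt_id hL (h.complexNormal h0)).norm_sq ℂ).mul
      ((contDiffAt_normalWeight η h h0).inv hw.ne')
  have h3 : ∀ᶠ w in 𝓝 p, (leviForm r w (L w) (L w)).im = 0 :=
    (h.two_of_infty.eventually (by simp)).mono fun w hw => leviForm_self_im hw _
  have h4 := holoDeriv_re_of_im_eq_zero (h1.differentiableAt (by simp)) h3 (complexNormal r p)
  have h5 := ((Complex.reCLM.differentiableAt.comp p (h1.differentiableAt (by simp))).hasFDerivAt.sub
    (hd.hasFDerivAt.mul (h2.differentiableAt (by simp)).hasFDerivAt)).fderiv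
  have h6 : fderiv ℝ (fun z => reducedForm r η z (L z)) p (complexNormal r p)
      = fderiv ℝ (fun z => (leviForm r z (L z) (L z)).re) p (complexNormal r p)
        - ‖gradient r p‖ * (‖leviForm r p (L p) (complexNormal r p)‖ ^ 2
          * (normalWeight r η p)⁻¹) := by
    refine (congrArg (fun A => A (complexNormal r p)) h5).trans ?_
    simp only [sub_apply, smul_apply, hr, zero_smul, zero_add, smul_eq_mul,
      fderiv_complexNormal hd h0]
    rw [mul_comm (‖gradient r p‖)]
    rfl
  rw [LeviInequalityAt, h4, h6, gradNorm, normalWeight, hr, zero_mul, add_zero, sub_nonpos,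
    sub_nonneg]
  have hη' : 0 < η - 1 := by linarith
  generalize fderiv ℝ (fun z => (leviForm r z (L z) (L z)).re) p (complexNormal r p) = D
  generalize ‖gradient r p‖ = a at ha
  generalize ‖leviForm r p (L p) (complexNormal r p)‖ ^ 2 = d
  have e1 : 1 / (η - 1) * (d / a ^ 2) = a * (d * ((η - 1) / 4 * a ^ 2)⁻¹) / (4 * a) := by
    field_simp
  have e2 : 1 / 2 * (1 / 2 * D / a) = D / (4 * a) := by
    field_simp
    ring
  rw [e1, e2, div_le_div_iff_of_pos_right (by positivity)]

theorem leviForm_rpow_self {r : CSpace n → ℝ} {z : CSpace n} (η : ℝ)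
    (h : ContDiffAt ℝ 2 r z) (h0 : 0 < r z) (x : CSpace n) :
    (leviForm (fun w => r w ^ η) z x x).re = η * r z ^ η / r z * powerLeviForm r η z x := by
  have h1 := leviForm_rpow_mul_exp (ψ := fun _ => 0) η h contDiffAt_const h0 x
  have h2 : hess (fun _ : CSpace n => (0 : ℝ)) z = 0 := by simp [hess]
  rw [h2] at h1
  simp only [Real.exp_zero, mul_one, fderiv_fun_const, Pi.zero_apply, zero_apply, add_zero] at h1
  rw [powerLeviForm, norm_inner_gradient_sq (h.differentiableAt (by simp)), leviForm_self_re h]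
  have h3 : ∀ a b : ℝ, 4 * a = 4 * b → a = b := fun a b hab => by linarith
  refine h3 _ _ (h1.trans ?_)
  field_simp
  ring

/-! ### Lower bounds outside the domain from the boundary inequality -/

/-- If `f` is nonnegative on the zero set of `r`, and its derivative along `v` is nonnegative at a
zero `p` of `r`, then on the positive side of that zero set `f` is bounded below by `-ε r`. -/
theorem eventually_ge_neg_mul_of_fderiv_nonneg {r : CSpace n → ℝ}
    {f : CSpace n × CSpace n → ℝ} {p X v : CSpace n}
    (hr : ContDiffAt ℝ 1 r p) (hrp : r p = 0) (hv : ‖v‖ = 1) (hrv : 0 < fderiv ℝ r p v)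
    (hf : ContDiffAt ℝ 1 f (p, X)) (hf0 : 0 ≤ fderiv ℝ f (p, X) (v, 0))
    (hnonneg : ∀ᶠ q in 𝓝 (p, X), r q.1 = 0 → 0 ≤ f q) {ε : ℝ} (hε : 0 < ε) :
    ∀ᶠ q in 𝓝 (p, X), 0 < r q.1 → -ε * r q.1 ≤ f q := by
  set a := fderiv ℝ r p v with ha
  have hrs := (hr.hasStrictFDerivAt (by simp)).isLittleO.def (c := a / 2) (by positivity)
  -- The zero set is reached from `z` along `-v` within distance `2 r z / a`, so an error rate of `ε
  -- a / 2` costs at most `ε * r z`.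
  have hfs := (hf.hasStrictFDerivAt (by simp)).isLittleO.def (c := ε * a / 2) (by positivity)
  have hcont : ∀ᶠ w in 𝓝 p, ContinuousAt r w :=
    (hr.eventually (by simp)).mono fun w hw => hw.continuousAt
  obtain ⟨δ₁, hδ₁, h₁⟩ := Metric.eventually_nhds_iff_ball.1 hrs
  obtain ⟨δ₂, hδ₂, h₂⟩ := Metric.eventually_nhds_iff_ball.1 hfs
  obtain ⟨δ₃, hδ₃, h₃⟩ := Metric.eventually_nhds_iff_ball.1 hnonneg
  obtain ⟨δ₄, hδ₄, h₄⟩ := Metric.eventually_nhds_iff_ball.1 hcont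
  set δ := min (min δ₁ δ₂) (min δ₃ δ₄)
  have hδ0 : 0 < δ := by positivity
  have hsmall : ∀ᶠ z in 𝓝 p, 2 * r z / a < δ / 2 := by
    have : ContinuousAt (fun z => 2 * r z / a) p :=
      (continuousAt_const.mul hr.continuousAt).div_const a
    exact this.eventually (gt_mem_nhds (by simp [hrp, hδ0]))
  rw [nhds_prod_eq]
  filter_upwards [(hsmall.and (Metric.ball_mem_nhds p (half_pos hδ0))).prod_mk
    (Metric.ball_mem_nhds X hδ0)] with q ⟨⟨hq1, hq2⟩, hq3⟩ hq0
  obtain ⟨z, Y⟩ := q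
  simp only at hq0 hq1 hq2 hq3 ⊢
  -- On this scale `r` decreases along `-v` at mean rate at least `a / 2`, so it is nonpositive
  -- after the length `s₁`.
  set s₁ := 2 * r z / a with hs₁
  have hs₁0 : 0 < s₁ := by positivity
  have hmem : ∀ s ∈ Set.Icc 0 s₁, z - s • v ∈ Metric.ball p δ := fun s hs => by
    rw [Metric.mem_ball]
    rw [dist_eq_norm] at hq2 ⊢
    calc ‖z - s • v - p‖ = ‖(z - p) - s • v‖ := by congr 1; abel
      _ ≤ ‖z - p‖ + ‖s • v‖ := norm_sub_le _ _
      _ = ‖z - p‖ + s := by rw [norm_smul, hv, Real.norm_of_nonneg hs.1, mul_one]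
      _ < δ := by linarith [hs.2]
  have hz : z ∈ Metric.ball p δ := by simpa using hmem 0 ⟨le_rfl, hs₁0.le⟩
  have hle₁ : δ ≤ δ₁ := (min_le_left _ _).trans (min_le_left _ _)
  have hle₂ : δ ≤ δ₂ := (min_le_left _ _).trans (min_le_right _ _)
  have hle₃ : δ ≤ δ₃ := (min_le_right _ _).trans (min_le_left _ _)
  have hle₄ : δ ≤ δ₄ := (min_le_right _ _).trans (min_le_right _ _)
  have hneg : r (z - s₁ • v) ≤ 0 := by
    have := h₁ (z, z - s₁ • v) (by
      rw [← ball_prod_same]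
      exact ⟨Metric.ball_subset_ball hle₁ hz,
        Metric.ball_subset_ball hle₁ (hmem s₁ ⟨hs₁0.le, le_rfl⟩)⟩)
    simp only [sub_sub_cancel, map_smul, norm_smul, hv, smul_eq_mul, ← ha, mul_one,
      Real.norm_of_nonneg hs₁0.le, Real.norm_eq_abs] at this
    have h5 := (abs_le.1 this).1
    have h6 : s₁ * a = 2 * r z := by rw [hs₁]; field_simp
    nlinarith
  have hcs : ContinuousOn (fun s : ℝ => r (z - s • v)) (Set.Icc 0 s₁) := fun s hs =>
    (ContinuousAt.comp (g := r) (f := fun s : ℝ => z - s • v)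
      (h₄ _ (Metric.ball_subset_ball hle₄ (hmem s hs)))
      (by fun_prop)).continuousWithinAt
  obtain ⟨s, hs, hs0⟩ := intermediate_value_Icc' hs₁0.le hcs
    (show (0 : ℝ) ∈ Set.Icc (r (z - s₁ • v)) (r (z - (0 : ℝ) • v)) from ⟨hneg, by simp [hq0.le]⟩)
  have hfπ : 0 ≤ f (z - s • v, Y) := h₃ (z - s • v, Y) (by
    rw [← ball_prod_same]
    exact ⟨Metric.ball_subset_ball hle₃ (hmem s hs), Metric.ball_subset_ball hle₃ hq3⟩) hs0
  have hdiff := h₂ ((z, Y), (z - s • v, Y)) (by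
    rw [← ball_prod_same, ← ball_prod_same]
    exact ⟨⟨Metric.ball_subset_ball hle₂ hz, Metric.ball_subset_ball hle₂ hq3⟩,
      ⟨Metric.ball_subset_ball hle₂ (hmem s hs), Metric.ball_subset_ball hle₂ hq3⟩⟩)
  have hvec : ((z, Y) : CSpace n × CSpace n) - (z - s • v, Y) = s • (v, 0) := by
    ext <;> simp
  have hnv : ‖((v, 0) : CSpace n × CSpace n)‖ = 1 := by simp [Prod.norm_def, hv]
  simp only [hvec, map_smul, norm_smul, hnv, smul_eq_mul, mul_one,
      Real.norm_of_nonneg hs.1, Real.norm_eq_abs] at hdiff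
  have h5 := (abs_le.1 hdiff).1
  have h6 : ε * a / 2 * s ≤ ε * r z := by
    have : s * a ≤ 2 * r z := by
      have := mul_le_mul_of_nonneg_right hs.2 hrv.le
      rwa [hs₁, div_mul_cancel₀ _ hrv.ne'] at this
    nlinarith
  have h7 : 0 ≤ s * fderiv ℝ f (p, X) (v, 0) := mul_nonneg hs.1 hf0
  linarith

theorem continuousAt_leviForm_re {r : CSpace n → ℝ} {p : CSpace n} (X : CSpace n)
    (h : ContDiffAt ℝ ∞ r p) :
    ContinuousAt (fun q : CSpace n × CSpace n => (leviForm r q.1 q.2 q.2).re) (p, X) :=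
  Complex.continuous_re.continuousAt.comp
    (ContDiffAt.leviForm (q := (p, X)) h contDiffAt_fst contDiffAt_snd contDiffAt_snd).continuousAt

/-- If `X` is not tangent, the normal term dominates; if `X` is tangent with positive Levi form,
continuity suffices. Only tangent null vectors need the boundary inequality, applied to the
projection of the constant field `X`. -/
theorem eventually_powerLeviForm_gt {r : CSpace n → ℝ} {p : CSpace n} {η : ℝ}
    (h : ContDiffAt ℝ ∞ r p) (h0 : gradient r p ≠ 0) (hr : r p = 0) (hη : 1 < η)
    (hpsc : ∀ᶠ z in 𝓝 p, r z = 0 → ∀ x, (inner ℂ (gradient r z) x : ℂ) = 0 →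
      0 ≤ (leviForm r z x x).re)
    (hineq : ∀ X, (inner ℂ (gradient r p) X : ℂ) = 0 → leviForm r p X X = 0 →
      LeviInequalityAt r (fun z => tangentPart r z X) η p) {ε : ℝ} (hε : 0 < ε) (X : CSpace n) :
    ∀ᶠ q in 𝓝 (p, X), 0 < r q.1 → -ε * r q.1 < powerLeviForm r η q.1 q.2 := by
  have hη' : 0 < η - 1 := by linarith
  have hlevi := continuousAt_leviForm_re X h
  have hgrad : ContinuousAt (fun q : CSpace n × CSpace n => gradient r q.1) (p, X) :=
    ContinuousAt.comp (g := gradient r) (f := Prod.fst) 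
      h.gradient_infty.continuousAt continuousAt_fst
  by_cases hX : (inner ℂ (gradient r p) X : ℂ) = 0
  swap
  -- Multiplication by `r` cancels the pole of the form: the product extends continuously to `r =
  -- 0`, with a positive value at `(p, X)`.
  · have h1 : ContinuousAt (fun q : CSpace n × CSpace n => r q.1 * (leviForm r q.1 q.2 q.2).re
        + (η - 1) / 4 * ‖(inner ℂ (gradient r q.1) q.2 : ℂ)‖ ^ 2) (p, X) :=
      ((h.continuousAt.comp (f := Prod.fst) continuousAt_fst).mul hlevi).add
        (continuousAt_const.mul ((ContinuousAt.inner (𝕜 := ℂ) hgrad continuousAt_snd).norm.pow 2))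
    have h2 := h1.eventually (lt_mem_nhds (a := 0) (by
      have := norm_pos_iff.2 hX
      simp only [hr, zero_mul, zero_add]
      exact mul_pos (by positivity) (pow_pos this 2)))
    filter_upwards [h2] with q hq hq0
    have h3 : r q.1 * powerLeviForm r η q.1 q.2 = r q.1 * (leviForm r q.1 q.2 q.2).re
        + (η - 1) / 4 * ‖(inner ℂ (gradient r q.1) q.2 : ℂ)‖ ^ 2 := by
      rw [powerLeviForm]
      field_simp
    rw [← h3] at hq
    have := pos_of_mul_pos_right hq hq0.le
    nlinarith
  by_cases hX' : leviForm r p X X = 0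
  swap
  · have h1 : 0 < (leviForm r p X X).re := by
      refine lt_of_le_of_ne (hpsc.self_of_nhds hr X hX) fun h1 => hX' ?_
      exact Complex.ext h1.symm (leviForm_self_im h.two_of_infty X)
    filter_upwards [hlevi.eventually (lt_mem_nhds h1)] with q hq hq0
    have : 0 ≤ (η - 1) / (4 * r q.1) * ‖(inner ℂ (gradient r q.1) q.2 : ℂ)‖ ^ 2 := by positivity
    rw [powerLeviForm]
    nlinarith
  have hd := h.two_of_infty.differentiableAt (by simp)
  have hw := normalWeight_pos h0 hr hη
  have hT : ∀ {F : Type} [NormedAddCommGroup F] [NormedSpace ℝ F] {f a : F → CSpace n} {q : F},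
      f q = p → ContDiffAt ℝ ∞ f q → ContDiffAt ℝ ∞ a q →
      ContDiffAt ℝ ∞ (fun s => reducedForm r η (f s) (tangentPart r (f s) (a s))) q :=
    fun hq hf ha => contDiffAt_reducedForm (hq ▸ h) (hq ▸ h0) (hq ▸ hw.ne') hf
      (ContDiffAt.tangentPart (hq ▸ h) (hq ▸ h0) hf ha)
  have hf := hT (q := (p, X)) rfl contDiffAt_fst contDiffAt_snd
  have hder := (leviInequalityAt_iff h h0 hr hη
    (ContDiffAt.tangentPart (f := fun z => z) (a := fun _ => X) h h0 contDiffAt_id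
      contDiffAt_const)).1 (hineq X hX hX')
  have hchain : fderiv ℝ (fun z => reducedForm r η z (tangentPart r z X)) p (complexNormal r p)
      = fderiv ℝ (fun q : CSpace n × CSpace n => reducedForm r η q.1 (tangentPart r q.1 q.2))
        (p, X) (complexNormal r p, 0) := by
    have h1 := HasFDerivAt.comp (f := fun z => (z, X)) p
      (hf.differentiableAt (by simp)).hasFDerivAt
      ((hasFDerivAt_id p).prodMk (hasFDerivAt_const X p))
    have h2 := congrArg (fun A => A (complexNormal r p)) h1.fderiv
    exact h2
  have hgrad0 : ∀ᶠ z in 𝓝 p, gradient r z ≠ 0 := h.gradient_infty.continuousAt.eventually_ne h0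
  have hpos : 0 < fderiv ℝ r p (complexNormal r p) := by
    rw [fderiv_complexNormal hd h0]
    exact norm_pos_iff.2 h0
  have hfst : Tendsto (Prod.fst : CSpace n × CSpace n → CSpace n) (𝓝 (p, X)) (𝓝 p) :=
    continuousAt_fst
  have hmain := eventually_ge_neg_mul_of_fderiv_nonneg (h.of_le (by simp)) hr
    (norm_complexNormal hd h0) hpos (hf.of_le (by simp)) (hchain ▸ hder)
    (by
      filter_upwards [hfst.eventually (hpsc.and hgrad0)] with q ⟨hq, hq'⟩ hq0
      rw [reducedForm, hq0, zero_mul, sub_zero]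
      exact hq hq0 _ (inner_gradient_tangentPart hq' _)) (half_pos hε)
  filter_upwards [hmain, hfst.eventually ((h.two_of_infty.eventually (by simp)).and
    (hgrad0.and ((contDiffAt_normalWeight η h h0).continuousAt.eventually (lt_mem_nhds hw))))]
    with q hq ⟨hq1, hq2, hq3⟩ hq0
  have := reducedForm_le_powerLeviForm hq1 hq2 hq0 hq3 q.2
  nlinarith [hq hq0]

/-- Compactness of the unit sphere makes the neighbourhood independent of the direction; homogeneity
of degree two does the rest. -/
theorem eventually_forall_powerLeviForm_gt {r : CSpace n → ℝ} {p : CSpace n} {η : ℝ}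
    (h : ContDiffAt ℝ ∞ r p) (h0 : gradient r p ≠ 0) (hr : r p = 0) (hη : 1 < η)
    (hpsc : ∀ᶠ z in 𝓝 p, r z = 0 → ∀ x, (inner ℂ (gradient r z) x : ℂ) = 0 →
      0 ≤ (leviForm r z x x).re)
    (hineq : ∀ X, (inner ℂ (gradient r p) X : ℂ) = 0 → leviForm r p X X = 0 →
      LeviInequalityAt r (fun z => tangentPart r z X) η p) {ε : ℝ} (hε : 0 < ε) :
    ∀ᶠ z in 𝓝 p, 0 < r z → ∀ x ≠ 0, -ε * r z * ‖x‖ ^ 2 < powerLeviForm r η z x := by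
  have h1 := (isCompact_sphere (0 : CSpace n) 1).eventually_forall_of_forall_eventually
    (x₀ := p) (P := fun z Y => 0 < r z → -ε * r z < powerLeviForm r η z Y)
    fun Y _ => eventually_powerLeviForm_gt h h0 hr hη hpsc hineq hε Y
  filter_upwards [h1] with z hz hz0 x hx
  have hx' : ‖x‖ ≠ 0 := norm_ne_zero_iff.2 hx
  have h2 := hz (((‖x‖⁻¹ : ℝ) : ℂ) • x) (by
    rw [mem_sphere_zero_iff_norm, norm_smul, Complex.norm_real, norm_inv, norm_norm,
      inv_mul_cancel₀ hx']) hz0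
  rw [powerLeviForm_smul, inv_pow, inv_mul_eq_div, lt_div_iff₀ (by positivity)] at h2
  exact h2

/-! ### Defining functions -/

/-- The properties of a defining function `ρ` on the neighbourhood `V` on which it is smooth. -/
structure IsDefiningFunctionOn (Ω V : Set (CSpace n)) (ρ : CSpace n → ℝ) : Prop where
  isOpen : IsOpen V
  closure_subset : closure Ω ⊆ V
  contDiffOn : ContDiffOn ℝ ∞ ρ V
  eq_sublevel : Ω = {z ∈ V | ρ z < 0}
  fderiv_ne_zero : ∀ z ∈ frontier Ω, fderiv ℝ ρ z ≠ 0

namespace IsDefiningFunctionOn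

variable {Ω V : Set (CSpace n)} {ρ : CSpace n → ℝ}

theorem contDiffAt (h : IsDefiningFunctionOn Ω V ρ) {z : CSpace n} (hz : z ∈ V) :
    ContDiffAt ℝ ∞ ρ z :=
  h.contDiffOn.contDiffAt (h.isOpen.mem_nhds hz)

theorem frontier_subset (h : IsDefiningFunctionOn Ω V ρ) : frontier Ω ⊆ V :=
  frontier_subset_closure.trans h.closure_subset

theorem mem_iff (h : IsDefiningFunctionOn Ω V ρ) {z : CSpace n} (hz : z ∈ V) :
    z ∈ Ω ↔ ρ z < 0 := by
  conv_lhs => rw [h.eq_sublevel]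
  exact and_iff_right hz

theorem notMem_closure_of_pos (h : IsDefiningFunctionOn Ω V ρ) {z : CSpace n} (hz : z ∈ V)
    (h0 : 0 < ρ z) : z ∉ closure Ω := fun hcl => by
  have h1 := ((h.contDiffAt hz).continuousAt.eventually (lt_mem_nhds h0)).and
    (h.isOpen.mem_nhds hz)
  obtain ⟨w, hw, hwV, hwΩ⟩ := ((mem_closure_iff_frequently.1 hcl).and_eventually h1).exists
  exact lt_asymm ((h.mem_iff hwΩ).1 hw) hwV

theorem isOpen_domain (h : IsDefiningFunctionOn Ω V ρ) : IsOpen Ω := by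
  rw [h.eq_sublevel]
  exact h.contDiffOn.continuousOn.isOpen_inter_preimage h.isOpen isOpen_Iio

theorem eq_zero_of_mem_frontier (h : IsDefiningFunctionOn Ω V ρ) {p : CSpace n}
    (hp : p ∈ frontier Ω) : ρ p = 0 := by
  have hV := h.frontier_subset hp
  refine le_antisymm (not_lt.1 fun h0 => h.notMem_closure_of_pos hV h0 hp.1) ?_
  rw [h.isOpen_domain.frontier_eq] at hp
  exact not_lt.1 fun h0 => hp.2 ((h.mem_iff hV).2 h0)

/-- Otherwise `ρ ≥ 0` near `z`, and `z` would be a local minimum with nonzero differential. -/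
theorem mem_closure_of_eq_zero (h : IsDefiningFunctionOn Ω V ρ) {z : CSpace n} (hz : z ∈ V)
    (h0 : ρ z = 0) (hd : fderiv ℝ ρ z ≠ 0) : z ∈ closure Ω := by
  by_contra hcl
  refine hd (IsLocalMin.fderiv_eq_zero ?_)
  filter_upwards [h.isOpen.mem_nhds hz, isClosed_closure.isOpen_compl.mem_nhds hcl] with w hw hw'
  rw [h0]
  exact not_lt.1 fun hlt => hw' (subset_closure ((h.mem_iff hw).2 hlt))

theorem mem_frontier_of_eq_zero (h : IsDefiningFunctionOn Ω V ρ) {z : CSpace n} (hz : z ∈ V)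
    (h0 : ρ z = 0) (hd : fderiv ℝ ρ z ≠ 0) : z ∈ frontier Ω := by
  rw [h.isOpen_domain.frontier_eq]
  exact ⟨h.mem_closure_of_eq_zero hz h0 hd, fun hΩ => ((h.mem_iff hz).1 hΩ).ne h0⟩

theorem isLocalDefiningFunction (h : IsDefiningFunctionOn Ω V ρ) {p : CSpace n}
    (hp : p ∈ frontier Ω) : IsLocalDefiningFunction Ω p ρ := by
  refine ⟨V, h.isOpen, h.frontier_subset hp, h.contDiffOn, ?_, h.fderiv_ne_zero p hp⟩
  rw [Set.inter_eq_left.2 (subset_closure.trans h.closure_subset)]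
  exact h.eq_sublevel

theorem continuousAt_fderiv (h : IsDefiningFunctionOn Ω V ρ) {z : CSpace n} (hz : z ∈ V) :
    ContinuousAt (fderiv ℝ ρ) z :=
  ((h.contDiffAt hz).fderiv_right (m := ∞) (by simp)).continuousAt

theorem eventually_mem (h : IsDefiningFunctionOn Ω V ρ) {p : CSpace n} (hp : p ∈ frontier Ω) :
    ∀ᶠ z in 𝓝 p, z ∈ V ∧ fderiv ℝ ρ z ≠ 0 :=
  (h.isOpen.eventually_mem (h.frontier_subset hp)).and
    ((h.continuousAt_fderiv (h.frontier_subset hp)).eventually_ne (h.fderiv_ne_zero p hp))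

/-- These fields suffice as test fields: each tangent vector at a boundary point is the value of one
of them. They may vanish elsewhere, so it matters that zeros are allowed. -/
theorem isTangentField_tangentPart (h : IsDefiningFunctionOn Ω V ρ) (X : CSpace n) :
    IsTangentField Ω ρ fun z => tangentPart ρ z X := by
  refine ⟨V ∩ fderiv ℝ ρ ⁻¹' {0}ᶜ,
    ContinuousOn.isOpen_inter_preimage (fun z hz => (h.continuousAt_fderiv hz).continuousWithinAt)
      h.isOpen isOpen_compl_singleton,
    fun p hp => ⟨h.frontier_subset hp, h.fderiv_ne_zero p hp⟩, fun z hz => ?_, fun z hz => ?_⟩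
  · exact (ContDiffAt.tangentPart (f := fun z => z) (a := fun _ => X) (h.contDiffAt hz.1)
      (gradient_ne_zero_iff.2 hz.2) contDiffAt_id contDiffAt_const).contDiffWithinAt
  · rw [holoDeriv_eq_inner ((h.contDiffAt hz.1).two_of_infty.differentiableAt (by simp)),
      inner_gradient_tangentPart (gradient_ne_zero_iff.2 hz.2), mul_zero]

theorem leviForm_nonneg (h : IsDefiningFunctionOn Ω V ρ) (hpsc : IsLeviPseudoconvex Ω)
    {p : CSpace n} (hp : p ∈ frontier Ω) {x : CSpace n}
    (hx : (inner ℂ (gradient ρ p) x : ℂ) = 0) : 0 ≤ (leviForm ρ p x x).re := by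
  refine hpsc p hp ρ (h.isLocalDefiningFunction hp) x ?_
  rw [holoDeriv_eq_inner ((h.contDiffAt (h.frontier_subset hp)).two_of_infty.differentiableAt
    (by simp)), hx, mul_zero]

theorem mul_exp (h : IsDefiningFunctionOn Ω V ρ) {ψ : CSpace n → ℝ} (hψ : ContDiff ℝ ∞ ψ) :
    IsDefiningFunctionOn Ω V fun z => ρ z * Real.exp (ψ z) where
  isOpen := h.isOpen
  closure_subset := h.closure_subset
  contDiffOn := h.contDiffOn.mul hψ.exp.contDiffOn
  eq_sublevel := by
    conv_lhs => rw [h.eq_sublevel]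
    ext z
    simp [mul_neg_iff, Real.exp_pos, (Real.exp_pos _).not_gt]
  fderiv_ne_zero p hp := by
    have h1 := ((h.contDiffAt (h.frontier_subset hp)).two_of_infty.differentiableAt
      (by simp)).hasFDerivAt.mul (hψ.exp.differentiable (by simp) p).hasFDerivAt
    have h2 : fderiv ℝ (fun z => ρ z * Real.exp (ψ z)) p = Real.exp (ψ p) • fderiv ℝ ρ p := by
      refine h1.fderiv.trans ?_
      rw [h.eq_zero_of_mem_frontier hp, zero_smul, zero_add]
    rw [h2]
    exact smul_ne_zero (Real.exp_ne_zero _) (h.fderiv_ne_zero p hp)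

end IsDefiningFunctionOn

theorem isDefiningFunction_iff {Ω : Set (CSpace n)} {ρ : CSpace n → ℝ} :
    IsDefiningFunction Ω ρ ↔ ∃ V, IsDefiningFunctionOn Ω V ρ :=
  ⟨fun ⟨V, h1, h2, h3, h4, h5⟩ => ⟨V, h1, h2, h3, h4, h5⟩,
    fun ⟨V, h1, h2, h3, h4, h5⟩ => ⟨V, h1, h2, h3, h4, h5⟩⟩

/-! ### From strict plurisubharmonicity to the boundary inequality -/

variable {Ω V : Set (CSpace n)} {ρ : CSpace n → ℝ}

/-- Strict plurisubharmonicity of `ρ ^ η` outside of `Ω` forces the inequality on the boundary. -/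
theorem leviInequalityAt_of_isStrictlyPlurisubharmonicOn (h : IsDefiningFunctionOn Ω V ρ) {η : ℝ}
    (hη : 1 < η) {U : Set (CSpace n)} (hU : IsOpen U) (hΩU : frontier Ω ⊆ U)
    (hpsh : IsStrictlyPlurisubharmonicOn (fun z => ρ z ^ η) ((closure Ω)ᶜ ∩ U))
    {L : CSpace n → CSpace n} (hL : IsTangentField Ω ρ L) {p : CSpace n}
    (hp : p ∈ leviNullSet Ω ρ L) : LeviInequalityAt ρ L η p := by
  obtain ⟨hp, hnull⟩ := hp
  obtain ⟨W, hW, hΩW, hLsm, hLtan⟩ := hL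
  have hs := h.contDiffAt (h.frontier_subset hp)
  have hd := hs.two_of_infty.differentiableAt (by simp)
  have h0 := gradient_ne_zero_iff.2 (h.fderiv_ne_zero p hp)
  have hr := h.eq_zero_of_mem_frontier hp
  have hw := normalWeight_pos h0 hr hη
  have hLp : ContDiffAt ℝ ∞ L p := hLsm.contDiffAt (hW.mem_nhds (hΩW hp))
  rw [leviInequalityAt_iff hs h0 hr hη hLp]
  set ν := complexNormal ρ p
  have hk := contDiffAt_reducedForm (η := η) (f := fun z => z) hs h0 hw.ne' contDiffAt_id hLp
  -- The reduced form on `L z` is the value of the full form at an actual vector `y`, hence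
  -- nonnegative; `y` may be zero.
  have hnear : ∀ᶠ z in 𝓝 p, 0 < ρ z → 0 ≤ reducedForm ρ η z (L z) := by
    filter_upwards [h.eventually_mem hp, hU.mem_nhds (hΩU hp), hW.mem_nhds (hΩW hp),
      (contDiffAt_normalWeight η hs h0).continuousAt.eventually (lt_mem_nhds hw)]
      with z ⟨hzV, hz0⟩ hzU hzW hzw hpos
    have hz2 := (h.contDiffAt hzV).two_of_infty
    have htan : (inner ℂ (gradient ρ z) (L z) : ℂ) = 0 := by
      have := hLtan z hzW
      rw [holoDeriv_eq_inner (hz2.differentiableAt (by simp))] at this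
      exact (mul_eq_zero.1 this).resolve_left (by norm_num)
    obtain ⟨y, hy⟩ := exists_powerLeviForm_eq_reducedForm hz2 (gradient_ne_zero_iff.2 hz0) hpos
      htan hzw
    rw [← hy]
    rcases eq_or_ne y 0 with rfl | hy0
    · simp [powerLeviForm, leviForm]
    · have := hpsh.2 z ⟨h.notMem_closure_of_pos hzV hpos, hzU⟩ y hy0
      rw [leviForm_rpow_self η hz2 hpos] at this
      exact (pos_of_mul_pos_right this (by positivity)).le
  have hline : HasDerivAt (fun t : ℝ => p + t • ν) ν 0 := by
    simpa using ((hasDerivAt_id (0 : ℝ)).smul_const ν).const_add p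
  have hline0 : p + (0 : ℝ) • ν = p := by simp
  have hρ : HasDerivAt (fun t : ℝ => ρ (p + t • ν)) ‖gradient ρ p‖ 0 := by
    rw [← fderiv_complexNormal hd h0]
    exact HasFDerivAt.comp_hasDerivAt (f := fun t : ℝ => p + t • ν) (l := ρ) 0
      (by rw [hline0]; exact hd.hasFDerivAt) hline
  have hkd : HasDerivAt (fun t : ℝ => reducedForm ρ η (p + t • ν) (L (p + t • ν)))
      (fderiv ℝ (fun z => reducedForm ρ η z (L z)) p ν) 0 :=
    HasFDerivAt.comp_hasDerivAt (f := fun t : ℝ => p + t • ν)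
      (l := fun z => reducedForm ρ η z (L z)) 0
      (by rw [hline0]; exact (hk.differentiableAt (by simp)).hasFDerivAt) hline
  have hk0 : reducedForm ρ η p (L p) = 0 := by simp [reducedForm, hr, hnull]
  have hρs := hρ.tendsto_slope_zero_right
  have hks := hkd.tendsto_slope_zero_right
  simp only [zero_add, zero_smul, add_zero, hr, hk0, sub_zero, smul_eq_mul] at hρs hks
  -- Along the ray from `p` in the direction `ν` the function `ρ` becomes positive at once, so the
  -- right difference quotients are nonnegative.
  refine ge_of_tendsto hks ?_
  have hcont : Tendsto (fun t : ℝ => p + t • ν) (𝓝[>] 0) (𝓝 p) := by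
    have := hline.continuousAt.tendsto
    rw [hline0] at this
    exact this.mono_left nhdsWithin_le_nhds
  filter_upwards [hcont.eventually hnear, self_mem_nhdsWithin,
    hρs.eventually (lt_mem_nhds (norm_pos_iff.2 h0))] with t ht (ht0 : 0 < t) htρ
  exact mul_nonneg (by positivity) (ht (pos_of_mul_pos_right htρ (by positivity)))

theorem boundaryExponent_le_steinnessExponent (h : IsDefiningFunction Ω ρ) :
    boundaryExponent Ω ρ ≤ steinnessExponent Ω ρ := by
  obtain ⟨V, hV⟩ := isDefiningFunction_iff.1 h
  refine sInf_le_sInf (Set.image_mono ?_)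
  rintro η ⟨hη, U, hU, hΩU, hpsh⟩
  exact ⟨hη, fun L hL p hp =>
    leviInequalityAt_of_isStrictlyPlurisubharmonicOn hV hη hU hΩU hpsh hL hp⟩

/-! ### From the boundary inequality to strict plurisubharmonicity -/

theorem fderiv_mul_norm_sq (ε : ℝ) : fderiv ℝ (fun z : CSpace n => ε * ‖z‖ ^ 2)
    = fun z => ε • 2 • innerSL ℝ z :=
  funext fun z => ((hasStrictFDerivAt_norm_sq z).hasFDerivAt.const_mul ε).fderiv

theorem hess_mul_norm_sq (ε : ℝ) (z v : CSpace n) :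
    hess (fun z : CSpace n => ε * ‖z‖ ^ 2) z v v = 2 * ε * ‖v‖ ^ 2 := by
  rw [hess, fderiv_mul_norm_sq]
  have h1 : HasFDerivAt (fun z : CSpace n => ε • 2 • innerSL ℝ z)
      (ε • 2 • (innerSL ℝ : CSpace n →L[ℝ] CSpace n →L[ℝ] ℝ)) z :=
    (((innerSL ℝ : CSpace n →L[ℝ] CSpace n →L[ℝ] ℝ).hasFDerivAt).const_smul 2).const_smul ε
  rw [h1.fderiv]
  simp only [smul_apply]
  rw [innerSL_apply_apply, real_inner_self_eq_norm_sq]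
  simp
  ring

/-- In the bracket of `leviForm_rpow_mul_exp` the weight gains `4ε|x|²`. The lower bound on the form
costs less than `2ε|x|²`, and the two cross terms cost at most `ε|x|²` each. -/
theorem leviForm_rpow_mul_exp_norm_sq_pos {z : CSpace n} {η η' ε R : ℝ} (hη : 1 < η)
    (hη' : η < η') (hs : ContDiffAt ℝ 2 ρ z) (h0 : 0 < ρ z) (hε : 0 < ε) (hR : ‖z‖ ≤ R)
    (hεR : 4 * (η' * η / (η' - η)) * R ^ 2 * ε ≤ 1) {x : CSpace n} (hx : x ≠ 0)
    (hform : -(ε / 2) * ρ z * ‖x‖ ^ 2 < powerLeviForm ρ η z x) :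
    0 < (leviForm (fun w => (ρ w * Real.exp (ε * ‖w‖ ^ 2)) ^ η') z x x).re := by
  have hψ : ContDiff ℝ 2 fun w : CSpace n => ε * ‖w‖ ^ 2 :=
    contDiff_const.mul (contDiff_norm_sq ℂ)
  have h1 := leviForm_rpow_mul_exp (ψ := fun w => ε * ‖w‖ ^ 2) η' hs hψ.contDiffAt h0 x
  have hIx : ‖Complex.I • x‖ = ‖x‖ := by simp [norm_smul]
  rw [hess_mul_norm_sq, hess_mul_norm_sq, hIx] at h1
  rw [powerLeviForm, norm_inner_gradient_sq (hs.differentiableAt (by simp)),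
    leviForm_self_re hs] at hform
  have hψd : ∀ v : CSpace n, ‖v‖ = ‖x‖ →
      fderiv ℝ (fun w : CSpace n => ε * ‖w‖ ^ 2) z v ^ 2 ≤ 4 * ε ^ 2 * R ^ 2 * ‖x‖ ^ 2 :=
    fun v hv => by
    have e1 : fderiv ℝ (fun w : CSpace n => ε * ‖w‖ ^ 2) z v = 2 * ε * inner ℝ z v := by
      rw [fderiv_mul_norm_sq]
      simp
      ring
    have e2 : |inner ℝ z v| ≤ R * ‖x‖ := (abs_real_inner_le_norm z v).trans (by
      rw [hv]
      gcongr)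
    have e3 : inner ℝ z v ^ 2 ≤ (R * ‖x‖) ^ 2 := sq_le_sq' (abs_le.1 e2).1 (abs_le.1 e2).2
    rw [e1]
    nlinarith [sq_nonneg ε]
  have hb1 := hψd x rfl
  have hb2 := hψd _ hIx
  set b₁ := fderiv ℝ (fun w : CSpace n => ε * ‖w‖ ^ 2) z x
  set b₂ := fderiv ℝ (fun w : CSpace n => ε * ‖w‖ ^ 2) z (Complex.I • x)
  set S := hess ρ z x x + hess ρ z (Complex.I • x) (Complex.I • x)
  have hdiv : ∀ v, fderiv ℝ ρ z v = ρ z * (fderiv ℝ ρ z v / ρ z) := fun v => by field_simp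
  rw [hdiv x, hdiv (Complex.I • x)] at hform
  set a₁ := fderiv ℝ ρ z x / ρ z
  set a₂ := fderiv ℝ ρ z (Complex.I • x) / ρ z
  have hS : -(2 * ε * ‖x‖ ^ 2) - (η - 1) * (a₁ ^ 2 + a₂ ^ 2) < S / ρ z := by
    rw [lt_div_iff₀ h0]
    have : (η - 1) / (4 * ρ z) * ((ρ z * a₁) ^ 2 + (ρ z * a₂) ^ 2)
        = (η - 1) * (a₁ ^ 2 + a₂ ^ 2) * ρ z / 4 := by field_simp
    rw [this] at hform
    linarith
  set C := η' * η / (η' - η) with hC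
  have hd : 0 < η' - η := by linarith
  have hC0 : 0 < C := by
    have : 0 < η' := by linarith
    positivity
  -- Completing the square in `a` uses `η' > η`; the remainder is exactly `-C b²`.
  have hsq : ∀ a b : ℝ, -(C * b ^ 2) ≤ η' * (a + b) ^ 2 - η * a ^ 2 := fun a b => by
    have : η' * (a + b) ^ 2 - η * a ^ 2 + C * b ^ 2
        = (η' - η) * (a + η' / (η' - η) * b) ^ 2 := by
      rw [hC]
      field_simp
      ring
    have h2 : 0 ≤ (η' - η) * (a + η' / (η' - η) * b) ^ 2 := by positivity
    linarith
  have hCb : ∀ b : ℝ, b ^ 2 ≤ 4 * ε ^ 2 * R ^ 2 * ‖x‖ ^ 2 → C * b ^ 2 ≤ ε * ‖x‖ ^ 2 :=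
    fun b hb => calc
      C * b ^ 2 ≤ C * (4 * ε ^ 2 * R ^ 2 * ‖x‖ ^ 2) := by gcongr
      _ = (4 * C * R ^ 2 * ε) * (ε * ‖x‖ ^ 2) := by ring
      _ ≤ 1 * (ε * ‖x‖ ^ 2) := by gcongr
      _ = ε * ‖x‖ ^ 2 := one_mul _
  have hpos : 0 < S / ρ z + (2 * ε * ‖x‖ ^ 2 + 2 * ε * ‖x‖ ^ 2) - a₁ ^ 2 - a₂ ^ 2
      + η' * (a₁ + b₁) ^ 2 + η' * (a₂ + b₂) ^ 2 := by
    linarith [hsq a₁ b₁, hsq a₂ b₂, hCb b₁ hb1, hCb b₂ hb2]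
  have : 0 < η' := by linarith
  have h2 : 0 < 4 * (leviForm (fun w => (ρ w * Real.exp (ε * ‖w‖ ^ 2)) ^ η') z x x).re := by
    rw [h1]
    positivity
  linarith

theorem steinnessIndex_le_of_leviInequalityAt (hbdd : Bornology.IsBounded Ω)
    (hpsc : IsLeviPseudoconvex Ω) (h : IsDefiningFunctionOn Ω V ρ) {η η' : ℝ} (hη : 1 < η)
    (hη' : η < η') (hineq : ∀ L : CSpace n → CSpace n, IsTangentField Ω ρ L →
      ∀ p ∈ leviNullSet Ω ρ L, LeviInequalityAt ρ L η p) :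
    steinnessIndex Ω ≤ (η' : EReal) := by
  obtain ⟨R, hR0, hR⟩ := hbdd.closure.subset_ball_lt 0 0
  have hd : 0 < η' - η := by linarith
  have hC0 : 0 < 4 * (η' * η / (η' - η)) * R ^ 2 := by
    have : 0 < η' := by linarith
    positivity
  -- This `ε` depends only on `η`, `η'` and the size of `Ω`, so one weight serves all boundary
  -- points.
  set ε := (4 * (η' * η / (η' - η)) * R ^ 2)⁻¹ with hε_def
  have hε : 0 < ε := inv_pos.2 hC0
  have hψ : ContDiff ℝ ∞ fun w : CSpace n => ε * ‖w‖ ^ 2 :=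
    contDiff_const.mul (contDiff_norm_sq ℂ)
  have hdef := isDefiningFunction_iff.2 ⟨V, h.mul_exp hψ⟩
  refine (iInf₂_le _ hdef).trans (sInf_le ⟨η', ⟨hη.trans hη', ?_⟩, rfl⟩)
  let P : CSpace n → Prop := fun z => (z ∈ V ∧ fderiv ℝ ρ z ≠ 0) ∧ z ∈ Metric.ball 0 R ∧
    (0 < ρ z → ∀ x ≠ 0, -(ε / 2) * ρ z * ‖x‖ ^ 2 < powerLeviForm ρ η z x)
  have hP : ∀ p ∈ frontier Ω, ∀ᶠ z in 𝓝 p, P z := fun p hp => by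
    have hs := h.contDiffAt (h.frontier_subset hp)
    have h0 := gradient_ne_zero_iff.2 (h.fderiv_ne_zero p hp)
    refine (h.eventually_mem hp).and ((Metric.isOpen_ball.eventually_mem (hR hp.1)).and
      (eventually_forall_powerLeviForm_gt hs h0 (h.eq_zero_of_mem_frontier hp) hη ?_ ?_
        (half_pos hε)))
    · filter_upwards [h.eventually_mem hp] with z ⟨hz, hz'⟩ hz0 x hx
      exact h.leviForm_nonneg hpsc (h.mem_frontier_of_eq_zero hz hz0 hz') hx
    · intro X hX hX'
      refine hineq _ (h.isTangentField_tangentPart X) p ⟨hp, ?_⟩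
      simpa only [tangentPart_eq_self hX] using hX'
  refine ⟨interior {z | P z}, isOpen_interior, fun p hp => mem_interior_iff_mem_nhds.2 (hP p hp),
    ?_⟩
  -- Where `dρ ≠ 0`, a zero of `ρ` in `V` lies in the closure, so `ρ` is strictly positive outside
  -- it.
  have hS : ∀ z ∈ (closure Ω)ᶜ ∩ interior {z | P z}, P z ∧ 0 < ρ z := fun z ⟨hz1, hz2⟩ => by
    have hPz : P z := interior_subset (s := {z | P z}) hz2
    refine ⟨hPz, lt_of_le_of_ne (not_lt.1 fun hlt => ?_) fun h0 => ?_⟩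
    · exact hz1 (subset_closure ((h.mem_iff hPz.1.1).2 hlt))
    · exact hz1 (h.mem_closure_of_eq_zero hPz.1.1 h0.symm hPz.1.2)
  refine ⟨fun z hz => ?_, fun z hz x hx => ?_⟩
  · obtain ⟨hPz, h0⟩ := hS z hz
    exact (contDiffAt_rpow_mul_exp η' (h.contDiffAt hPz.1.1).two_of_infty
      (hψ.contDiffAt.two_of_infty) h0).contDiffWithinAt
  · obtain ⟨⟨⟨hzV, -⟩, hzR, hform⟩, h0⟩ := hS z hz
    exact leviForm_rpow_mul_exp_norm_sq_pos hη hη' (h.contDiffAt hzV).two_of_infty h0 hε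
      (mem_ball_zero_iff.1 hzR).le (by rw [hε_def, mul_inv_cancel₀ hC0.ne']) hx (hform h0 x hx)

end

theorem theorem3p1 {n : ℕ} (hn : 2 ≤ n) (Ω : Set (CSpace n))
    (hopen : IsOpen Ω) (hconn : IsConnected Ω) (hbdd : Bornology.IsBounded Ω)
    (hsmooth : HasSmoothBoundary Ω) (hpsc : IsLeviPseudoconvex Ω) :
    steinnessIndex Ω =
      ⨅ (ρ : CSpace n → ℝ) (_ : IsDefiningFunction Ω ρ), boundaryExponent Ω ρ := by
  refine le_antisymm (le_iInf₂ fun ρ hρ => le_sInf ?_)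
    (iInf₂_mono fun ρ hρ => boundaryExponent_le_steinnessExponent hρ)
  rintro _ ⟨η, ⟨hη, hineq⟩, rfl⟩
  obtain ⟨V, hV⟩ := isDefiningFunction_iff.1 hρ
  -- The gap `η' - η` is arbitrary, so it disappears in the limit.
  refine EReal.le_of_forall_lt_iff_le.1 fun η' hη' => ?_
  exact steinnessIndex_le_of_leviInequalityAt hbdd hpsc hV hη (EReal.coe_lt_coe_iff.1 hη') hineq
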